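/- Let $\mathbb K$ be $\mathbb R$ or $\mathbb C$, let $X$ be a Banach space over $\mathbb K$, and let $1<p<\infty$. For $A\subset\mathbb K$ let $\beta_{p,X}^A\in[0,\infty]$ be the least $\beta$ such that $$\Bigl(\mathbb E\Bigl\|\sum_{n=1}^N\varepsilon_nd_n\Bigr\|^p\Bigr)^{1/p}\le\beta\Bigl(\mathbb E\Bigl\|\sum_{n=1}^Nd_n\Bigr\|^p\Bigr)^{1/p}$$ for every $X$-valued $L^p$-martingale difference sequence $(d_n)_{n=1}^N$ on any probability space and all $\varepsilon_1,\dots,\varepsilon_N\in A$. The space $X$ is called UMD if $\beta_{q,X}^{\{\varepsilon\in\mathbb K:|\varepsilon|=1\}}<\infty$ for some (equivalently, for all) $1<q<\infty$. Let $d\ge1$ and let $m:\mathbb R^d\to\mathbb K$ be even, homogeneous of degree $0$ (that is, $m(cx)=m(x)$ for all $c>0$ and $x\in\mathbb R^d$), and continuous on $\mathbb R^d\setminus\{0\}$; put $A:=m(\mathbb R^d\setminus\{0\})$. Let $T_m$ be the Fourier multiplier with symbol $m$, defined on $\mathcal S(\mathbb R^d;\mathbb K)\otimes X$ by $T_m(f\otimes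 x)=\mathcal F^{-1}(m\,\mathcal F f)\cdot x$, and let $\|T_m\|_{\mathcal L(L^p(\mathbb R^d;X))}\in[0,\infty]$ be its norm with respect to the $L^p(\mathbb R^d;X)$-norm (with the value $\infty$ if $T_m$ has no bounded extension to $L^p(\mathbb R^d;X)$). Then $$\|T_m\|_{\mathcal L(L^p(\mathbb R^d;X))}\ge\beta_{p,X}^A .$$ In particular, if $X$ is not UMD and $m$ is not constant on $\mathbb R^d\setminus\{0\}$, then $T_m$ is unbounded on $L^p(\mathbb R^d;X)$. -/

import Mathlib

open MeasureTheory ProbabilityTheory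
open scoped ENNReal NNReal FourierTransform SchwartzMap

universe u v w

noncomputable section

/-- `d 0, d 1, …` is the difference sequence of an `X`-valued martingale with respect to `ℱ`:
the partial sums `d 0 + ⋯ + d n` form a martingale (so `d 0` is the initial value of that
martingale, and need not be centred). A finite difference sequence is one that is extended by
zeros. -/
def IsMartingaleDifference {Ω X : Type*} {mΩ : MeasurableSpace Ω} [NormedAddCommGroup X]
    [NormedSpace ℝ X] [CompleteSpace X] (d : ℕ → Ω → X) (ℱ : Filtration ℕ mΩ)
    (μ : Measure Ω) : Prop :=
  Martingale (fun n ω => ∑ i ∈ Finset.range (n + 1), d i ω) ℱ μ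

/-- `β` is admissible for the UMD inequality of exponent `p` with coefficients in `A`:
`‖∑ εₙ dₙ‖_{L^p(Ω; X)} ≤ β ‖∑ dₙ‖_{L^p(Ω; X)}` for every probability space, every finite
`X`-valued `L^p` martingale difference sequence `(dₙ)` and all scalars `εₙ ∈ A`. -/
def UMDBound {𝕜 : Type w} [RCLike 𝕜] (X : Type u) [NormedAddCommGroup X] [NormedSpace ℝ X]
    [NormedSpace 𝕜 X] [CompleteSpace X] (p : ℝ≥0∞) (A : Set 𝕜) (β : ℝ≥0∞) : Prop :=
  ∀ (Ω : Type v) (mΩ : MeasurableSpace Ω) (μ : Measure Ω), IsProbabilityMeasure μ →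
    ∀ (ℱ : Filtration ℕ mΩ) (d : ℕ → Ω → X), IsMartingaleDifference d ℱ μ →
      (∀ n, MemLp (d n) p μ) →
      ∀ (N : ℕ) (ε : ℕ → 𝕜), (∀ n, ε n ∈ A) →
        eLpNorm (fun ω => ∑ n ∈ Finset.range N, ε n • d n ω) p μ ≤
          β * eLpNorm (fun ω => ∑ n ∈ Finset.range N, d n ω) p μ

/-- The constant `β_{p,X}^A ∈ [0, ∞]`: the least admissible `β`, and `∞` if there is no finite
one. -/
def umdConst {𝕜 : Type w} [RCLike 𝕜] (X : Type u) [NormedAddCommGroup X] [NormedSpace ℝ X]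
    [NormedSpace 𝕜 X] [CompleteSpace X] (p : ℝ≥0∞) (A : Set 𝕜) : ℝ≥0∞ :=
  sInf {β : ℝ≥0∞ | UMDBound.{u, v, w} X p A β}

/-- `X` is a UMD Banach space over `𝕜`: for some `1 < p < ∞` the UMD inequality holds with a
finite constant for all unimodular scalars. -/
def IsUMD (𝕜 : Type w) [RCLike 𝕜] (X : Type u) [NormedAddCommGroup X] [NormedSpace ℝ X]
    [NormedSpace 𝕜 X] [CompleteSpace X] : Prop :=
  ∃ p : ℝ≥0∞, 1 < p ∧ p < ⊤ ∧ ∃ β : ℝ≥0, UMDBound.{u, v, w} X p {ε : 𝕜 | ‖ε‖ = 1} (β : ℝ≥0∞)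

/-- The Fourier multiplier `f ↦ F⁻¹ (m · F f)` on scalar Schwartz functions, for the Fourier
transforms `F f t = (2π)^(-d) ∫ exp (-i⟨t, u⟩) f u du` and `F⁻¹ g t = ∫ exp (i⟨t, u⟩) g u du`.
In terms of the transform `𝓕` with kernel `exp (-2πi⟨t, u⟩)`, the substitution `u = 2πξ` in the
outer integral turns the symbol into `ξ ↦ m (2πξ)`.
For `𝕜 = ℂ` both maps `RCLike.map` are the identity. For `𝕜 = ℝ` the first one is the inclusion
`ℝ → ℂ` and the second one is the real part; for an even symbol, the function it is applied to
is then real-valued, so nothing is lost. -/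
def scalarMultiplier {𝕜 : Type w} [RCLike 𝕜] {d : ℕ} (m : EuclideanSpace ℝ (Fin d) → 𝕜)
    (f : 𝓢(EuclideanSpace ℝ (Fin d), 𝕜)) (t : EuclideanSpace ℝ (Fin d)) : 𝕜 :=
  RCLike.map ℂ 𝕜
    (𝓕⁻ (fun ξ : EuclideanSpace ℝ (Fin d) =>
      RCLike.map 𝕜 ℂ (m ((2 * Real.pi) • ξ)) *
        𝓕 (fun s : EuclideanSpace ℝ (Fin d) => RCLike.map 𝕜 ℂ (f s)) ξ) t)

/-- `C` bounds `T_m` on `L^p(ℝ^d; X)`: `‖T_m f‖_p ≤ C ‖f‖_p` for every `f = ∑ f_k ⊗ x_k` in the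
dense subspace `𝓢(ℝ^d) ⊗ X`, where `T_m (f_k ⊗ x_k) = F⁻¹ (m · F f_k) · x_k`. -/
def MultiplierBound {𝕜 : Type w} [RCLike 𝕜] {d : ℕ} (X : Type u) [NormedAddCommGroup X]
    [NormedSpace 𝕜 X] (p : ℝ≥0∞) (m : EuclideanSpace ℝ (Fin d) → 𝕜) (C : ℝ≥0∞) : Prop :=
  ∀ (K : ℕ) (f : Fin K → 𝓢(EuclideanSpace ℝ (Fin d), 𝕜)) (x : Fin K → X),
    eLpNorm (fun t => ∑ k, scalarMultiplier m (f k) t • x k) p volume ≤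
      C * eLpNorm (fun t => ∑ k, f k t • x k) p volume

/-- The norm of `T_m` on `L^p(ℝ^d; X)`, as an element of `[0, ∞]`; it is `∞` exactly when `T_m`
has no bounded extension from `𝓢(ℝ^d) ⊗ X` to `L^p(ℝ^d; X)`. -/
def multiplierNorm {𝕜 : Type w} [RCLike 𝕜] {d : ℕ} (X : Type u) [NormedAddCommGroup X]
    [NormedSpace 𝕜 X] (p : ℝ≥0∞) (m : EuclideanSpace ℝ (Fin d) → 𝕜) : ℝ≥0∞ :=
  sInf {C : ℝ≥0∞ | MultiplierBound X p m C}

end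

/-! The multiplier acts on suitable high-frequency functions almost as a martingale transform.
Choose directions `ξ i` with `m (ξ i) = ε i`, and send the character of frequency `k` on the torus
to the character of frequency `∑ k i * L ^ (i + 1) • ξ i` on `ℝᵈ`. For large `L` the last nonzero
coordinate of `k`, its top index, dominates. Since `m` is even, homogeneous and continuous away from
`0`, its value near this frequency tends to `m (ξ i)` with `i` the top index. Hence on a fixed bump
`φ` times such a character, the multiplier is asymptotically multiplication by `ε i`, uniformly on
`ℝᵈ`.

The images of the points of `ℝᵈ` equidistribute on the torus as `L → ∞`, so `L^p` norms over `ℝᵈ`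
converge to `‖φ‖_p` times `L^p` norms over the torus. Dividing by `‖φ‖_p` yields the transform
inequality for trigonometric polynomials without constant term (`eLpNorm_le_of_mem_trigPairs`). A
function of the first `n + 1` torus variables with mean zero in the last is an `L^p` limit of
polynomials all of whose terms have top index `n`, so the inequality passes to martingale
differences along the coordinate filtration (`IsTrigLimit.snoc`, `IsTrigLimit.eLpNorm_le`).

A general martingale reduces to this one. One independent random sign applied to the whole sequence
centres the initial term and leaves all the norms unchanged; the law of the resulting sequence is
then rebuilt on the torus, one coordinate per step, from conditional distributions (`map_torusPath`,
`eLpNorm_sum_smul_le_of_centered`).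

For the last claim, a nonconstant `m` supplies two distinct coefficients. An affine change gives the
coefficients `0` and `1`, convexity gives `[0, 1]`, and splitting scalars into parts gives all
unimodular ones (`isUMD_of_umdBound`). -/

open Filter Topology UnitAddTorus

noncomputable section

/-! ### Lacunary frequencies and the limit of the symbol along them. -/

section Lacunary

variable {V : Type*} [NormedAddCommGroup V] [InnerProductSpace ℝ V]

/-- The frequency in `V` obtained from `k ∈ ℤⁿ` by giving the coordinate `k i` the direction `ξ i`
and the size `L ^ (i + 1)`. -/
def lacunaryFreq (ξ : ℕ → V) (L : ℕ) {n : ℕ} (k : Fin n → ℤ) : V :=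
  ∑ i, ((k i : ℝ) * (L : ℝ) ^ ((i : ℕ) + 1)) • ξ i

/-- The map from `V` to the torus with frequencies `L ^ (i + 1) • ξ i`. -/
def lacunaryMap (ξ : ℕ → V) (L n : ℕ) (t : V) : UnitAddTorus (Fin n) :=
  fun i => (((L : ℝ) ^ ((i : ℕ) + 1) * inner ℝ (ξ i) t : ℝ) : UnitAddCircle)

lemma continuous_lacunaryMap (ξ : ℕ → V) (L n : ℕ) : Continuous (lacunaryMap ξ L n) := by
  refine continuous_pi fun i => ?_
  exact (AddCircle.continuous_mk' 1).comp (by fun_prop)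

lemma mFourier_lacunaryMap (ξ : ℕ → V) (L : ℕ) {n : ℕ} (k : Fin n → ℤ) (t : V) :
    mFourier k (lacunaryMap ξ L n t) = (Real.fourierChar (inner ℝ (lacunaryFreq ξ L k) t) : ℂ) := by
  simp only [mFourier, lacunaryMap, ContinuousMap.coe_mk, fourier_coe_apply, Real.fourierChar_apply]
  rw [← Complex.exp_sum]
  congr 1
  rw [lacunaryFreq, sum_inner]
  push_cast
  rw [Finset.mul_sum, Finset.sum_mul]
  refine Finset.sum_congr rfl fun i _ => ?_
  rw [inner_smul_left]
  simp
  ring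

/-- After division by the top power of `L`, each lower term carries a negative power of `L`, and
there are no higher terms. -/
lemma tendsto_inv_smul_lacunaryFreq (ξ : ℕ → V) {n : ℕ} (k : Fin n → ℤ) (i : Fin n)
    (hk : ∀ j, i < j → k j = 0) :
    Tendsto (fun L : ℕ => ((L : ℝ) ^ ((i : ℕ) + 1))⁻¹ • lacunaryFreq ξ L k) atTop
      (𝓝 ((k i : ℝ) • ξ i)) := by
  have : ((k i : ℝ) • ξ i) = ∑ j, if j = i then (k i : ℝ) • ξ i else 0 := by simp
  rw [this]
  simp only [lacunaryFreq, Finset.smul_sum]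
  refine tendsto_finsetSum _ fun j _ => ?_
  rcases lt_trichotomy j i with h | h | h
  · rw [if_neg h.ne]
    rw [← zero_smul ℝ (ξ j)]
    simp only [smul_smul]
    refine Tendsto.smul_const ?_ _
    rw [← mul_zero (k j : ℝ)]
    have h1 : Tendsto (fun L : ℕ => ((L : ℝ) ^ ((i : ℕ) - j))⁻¹) atTop (𝓝 0) :=
      tendsto_inv_atTop_zero.comp ((tendsto_pow_atTop (by
        have : (j : ℕ) < i := h
        omega)).comp tendsto_natCast_atTop_atTop)
    refine (h1.const_mul (k j : ℝ)).congr' ?_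
    filter_upwards [eventually_gt_atTop 0] with L hL
    have hL' : (L : ℝ) ≠ 0 := by positivity
    have : (i : ℕ) + 1 = (i - j) + (j + 1) := by
      have : (j : ℕ) < i := h
      omega
    rw [this, pow_add]
    field_simp
  · subst h
    rw [if_pos rfl]
    refine tendsto_const_nhds.congr' ?_
    filter_upwards [eventually_gt_atTop 0] with L hL
    have hL' : (L : ℝ) ≠ 0 := by positivity
    rw [smul_smul]
    congr 1
    field_simp
  · rw [if_neg h.ne', hk j h]
    simp

/-- Homogeneity permits rescaling by `L ^ (i + 1)`, which makes the fixed shift `η` negligible; the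
exponent is positive even for `i = 0`. Evenness removes the sign of `k i`. -/
lemma tendsto_symbol_lacunaryFreq {Z : Type*} [TopologicalSpace Z] {M : V → Z}
    (heven : ∀ x, M (-x) = M x) (hhom : ∀ c : ℝ, 0 < c → ∀ x, M (c • x) = M x)
    (hcont : ContinuousOn M {0}ᶜ) (ξ : ℕ → V) {n : ℕ} (k : Fin n → ℤ) (i : Fin n)
    (hξ : ξ i ≠ 0) (hki : k i ≠ 0) (hk : ∀ j, i < j → k j = 0) (η : V) :
    Tendsto (fun L : ℕ => M (lacunaryFreq ξ L k + η)) atTop (𝓝 (M (ξ i))) := by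
  have hki' : (k i : ℝ) ≠ 0 := by exact_mod_cast hki
  have hne : ((k i : ℝ) • ξ i) ≠ 0 := smul_ne_zero hki' hξ
  have hM : M ((k i : ℝ) • ξ i) = M (ξ i) := by
    rcases lt_or_gt_of_ne hki' with h | h
    · rw [← heven, ← neg_smul, hhom _ (by linarith)]
    · exact hhom _ h _
  have h1 : Tendsto (fun L : ℕ => ((L : ℝ) ^ ((i : ℕ) + 1))⁻¹ • (lacunaryFreq ξ L k + η)) atTop
      (𝓝 ((k i : ℝ) • ξ i)) := by
    simp only [smul_add]
    rw [← add_zero ((k i : ℝ) • ξ i)]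
    refine (tendsto_inv_smul_lacunaryFreq ξ k i hk).add ?_
    rw [← zero_smul ℝ η]
    refine Tendsto.smul_const ?_ _
    exact tendsto_inv_atTop_zero.comp ((tendsto_pow_atTop (by omega)).comp
      tendsto_natCast_atTop_atTop)
  have h2 := ((hcont.continuousAt (isOpen_compl_singleton.mem_nhds hne)).tendsto).comp h1
  rw [hM] at h2
  refine h2.congr' ?_
  filter_upwards [eventually_gt_atTop 0] with L hL
  exact hhom _ (by positivity) _

lemma tendsto_lacunaryFreq_cocompact [FiniteDimensional ℝ V] (ξ : ℕ → V) {n : ℕ} (k : Fin n → ℤ)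
    (i : Fin n) (hξ : ξ i ≠ 0) (hki : k i ≠ 0) (hk : ∀ j, i < j → k j = 0) :
    Tendsto (fun L : ℕ => lacunaryFreq ξ L k) atTop (cocompact V) := by
  have hki' : (k i : ℝ) ≠ 0 := by exact_mod_cast hki
  have : ProperSpace V := FiniteDimensional.proper_real V
  rw [← Metric.cobounded_eq_cocompact, ← tendsto_norm_atTop_iff_cobounded]
  have h1 := (tendsto_inv_smul_lacunaryFreq ξ k i hk).norm
  have h2 : Tendsto (fun L : ℕ => (L : ℝ) ^ ((i : ℕ) + 1)) atTop atTop :=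
    (tendsto_pow_atTop (by omega)).comp tendsto_natCast_atTop_atTop
  refine (h2.atTop_mul_pos (norm_pos_iff.2 (smul_ne_zero hki' hξ)) h1).congr' ?_
  filter_upwards [eventually_gt_atTop 0] with L hL
  have hL' : (0 : ℝ) < (L : ℝ) ^ ((i : ℕ) + 1) := by positivity
  rw [norm_smul, norm_inv, Real.norm_of_nonneg hL'.le]
  field_simp

lemma exists_top_index {n : ℕ} {k : Fin n → ℤ} (hk : k ≠ 0) :
    ∃ i, k i ≠ 0 ∧ ∀ j, i < j → k j = 0 := by
  classical
  have hne : (Finset.univ.filter fun i => k i ≠ 0).Nonempty := by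
    obtain ⟨i, hi⟩ := Function.ne_iff.1 hk
    exact ⟨i, by simpa using hi⟩
  refine ⟨_, (Finset.mem_filter.1 (Finset.max'_mem _ hne)).2, fun j hj => ?_⟩
  by_contra h
  exact absurd (Finset.le_max' _ j (by simpa using h)) (not_le.2 hj)

end Lacunary

/-! ### Equidistribution of the lacunary maps on the torus. -/

/-- The normalised Haar measure on the torus `(ℝ / ℤ)ⁿ`. -/
def torusMeasure (n : ℕ) : Measure (UnitAddTorus (Fin n)) :=
  Measure.pi fun _ => AddCircle.haarAddCircle

instance (n : ℕ) : IsProbabilityMeasure (torusMeasure n) := by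
  unfold torusMeasure; infer_instance

lemma integral_fourier_haarAddCircle {k : ℤ} (hk : k ≠ 0) :
    ∫ x : UnitAddCircle, fourier k x ∂AddCircle.haarAddCircle = 0 := by
  have h1 := (orthonormal_fourier (T := 1)).2 (i := 0) (j := k) (Ne.symm hk)
  beta_reduce at h1
  rw [fourierLp, fourierLp, ContinuousMap.inner_toLp] at h1
  simpa using h1

lemma integral_mFourier_torusMeasure {n : ℕ} {k : Fin n → ℤ} (hk : k ≠ 0) :
    ∫ θ, mFourier k θ ∂torusMeasure n = 0 := by
  obtain ⟨i, hi⟩ := Function.ne_iff.1 hk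
  simp only [mFourier, ContinuousMap.coe_mk, torusMeasure]
  rw [integral_fintype_prod_eq_prod (μ := fun _ : Fin n => AddCircle.haarAddCircle (T := 1))
    (f := fun i (x : UnitAddCircle) => (fourier (k i) x : ℂ))]
  exact Finset.prod_eq_zero (Finset.mem_univ i) (integral_fourier_haarAddCircle hi)

section Equidistribution

variable {V : Type*} [NormedAddCommGroup V] [InnerProductSpace ℝ V] [FiniteDimensional ℝ V]
  [MeasurableSpace V] [BorelSpace V]

lemma norm_integral_mul_comp_sub_le {n : ℕ} {w : V → ℂ} (hw : Integrable w)
    (H H' : C(UnitAddTorus (Fin n), ℂ)) {γ : V → UnitAddTorus (Fin n)} (hγ : Continuous γ) :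
    ‖(∫ t, w t * H (γ t)) - ∫ t, w t * H' (γ t)‖ ≤ (∫ t, ‖w t‖) * ‖H - H'‖ := by
  have hi : ∀ H : C(UnitAddTorus (Fin n), ℂ), Integrable fun t => w t * H (γ t) := fun H =>
    hw.mul_bdd (c := ‖H‖) (H.continuous.comp hγ).aestronglyMeasurable
      (ae_of_all _ fun t => H.norm_coe_le_norm _)
  rw [← integral_sub (hi _) (hi _), ← integral_mul_const]
  refine norm_integral_le_of_norm_le (hw.norm.mul_const _) (ae_of_all _ fun t => ?_)
  rw [← mul_sub, norm_mul]
  gcongr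
  exact (H - H').norm_coe_le_norm _

lemma norm_integral_torusMeasure_sub_le {n : ℕ} (H H' : C(UnitAddTorus (Fin n), ℂ)) :
    ‖(∫ θ, H θ ∂torusMeasure n) - ∫ θ, H' θ ∂torusMeasure n‖ ≤ ‖H - H'‖ := by
  have hi : ∀ H : C(UnitAddTorus (Fin n), ℂ), Integrable (fun t => H t) (torusMeasure n) := fun H =>
    Integrable.of_bound H.continuous.aestronglyMeasurable ‖H‖
      (ae_of_all _ fun t => H.norm_coe_le_norm _)
  rw [← integral_sub (hi _) (hi _)]
  refine (norm_integral_le_of_norm_le_const (C := ‖H - H'‖)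
    (ae_of_all _ fun t => (H - H').norm_coe_le_norm t)).trans_eq ?_
  simp

/-- Weyl's argument: for a nontrivial character the frequency on `V` escapes to infinity and the
Riemann–Lebesgue lemma gives the limit `0`. Linearity and the uniform density of trigonometric
polynomials do the rest. -/
theorem tendsto_integral_mul_comp_lacunaryMap {ξ : ℕ → V} (hξ : ∀ i, ξ i ≠ 0) {n : ℕ}
    {w : V → ℂ} (hw : Integrable w) (H : C(UnitAddTorus (Fin n), ℂ)) :
    Tendsto (fun L : ℕ => ∫ t, w t * H (lacunaryMap ξ L n t)) atTop
      (𝓝 ((∫ t, w t) * ∫ θ, H θ ∂torusMeasure n)) := by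
  have hi : ∀ (H : C(UnitAddTorus (Fin n), ℂ)) (L : ℕ),
      Integrable fun t => w t * H (lacunaryMap ξ L n t) := fun H L =>
    hw.mul_bdd (c := ‖H‖) (H.continuous.comp (continuous_lacunaryMap ξ L n)).aestronglyMeasurable
      (ae_of_all _ fun t => H.norm_coe_le_norm _)
  have hi' : ∀ H : C(UnitAddTorus (Fin n), ℂ), Integrable (fun t => H t) (torusMeasure n) := fun H =>
    Integrable.of_bound H.continuous.aestronglyMeasurable ‖H‖
      (ae_of_all _ fun t => H.norm_coe_le_norm _)
  have hspan : ∀ H ∈ Submodule.span ℂ (Set.range (mFourier (d := Fin n))),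
      Tendsto (fun L : ℕ => ∫ t, w t * H (lacunaryMap ξ L n t)) atTop
      (𝓝 ((∫ t, w t) * ∫ θ, H θ ∂torusMeasure n)) := by
    intro H hH
    induction hH using Submodule.span_induction with
    | mem H hH =>
      obtain ⟨k, rfl⟩ := hH
      by_cases hk : k = 0
      · subst hk
        simp [mFourier_zero]
      · rw [integral_mFourier_torusMeasure hk, mul_zero]
        obtain ⟨i, hki, hk⟩ := exists_top_index hk
        have h1 := tendsto_lacunaryFreq_cocompact ξ k i (hξ i) hki hk
        -- The Riemann–Lebesgue lemma is stated with the kernel of the opposite sign.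
        have hneg : Tendsto (fun v : V => -v) (cocompact V) (cocompact V) :=
          (Homeomorph.neg V).isClosedEmbedding.tendsto_cocompact
        refine ((tendsto_integral_exp_inner_smul_cocompact w).comp (hneg.comp h1)).congr fun L => ?_
        simp only [Function.comp_apply]
        refine integral_congr_ae (ae_of_all _ fun t => ?_)
        simp only [mFourier_lacunaryMap, inner_neg_right, neg_neg, Circle.smul_def, smul_eq_mul]
        rw [mul_comm, real_inner_comm]
    | zero => simp
    | add H H' _ _ h1 h2 =>
      simp only [ContinuousMap.add_apply, mul_add]
      rw [integral_add (hi' _) (hi' _), mul_add]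
      refine (h1.add h2).congr fun L => ?_
      rw [integral_add (hi _ _) (hi _ _)]
    | smul c H _ h1 =>
      simp only [ContinuousMap.smul_apply, smul_eq_mul]
      rw [integral_const_mul, mul_left_comm]
      refine (h1.const_mul c).congr fun L => ?_
      rw [← integral_const_mul]
      congr 1 with t
      ring
  rw [Metric.tendsto_atTop]
  intro δ hδ
  set W := ∫ t, ‖w t‖
  have hW : 0 ≤ W := integral_nonneg fun _ => norm_nonneg _
  have hH : H ∈ closure (Submodule.span ℂ (Set.range (mFourier (d := Fin n))) :
      Set C(UnitAddTorus (Fin n), ℂ)) := by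
    rw [← Submodule.topologicalClosure_coe, span_mFourier_closure_eq_top]
    trivial
  obtain ⟨H', hH', hd⟩ := Metric.mem_closure_iff.1 hH (δ / (3 * (W + 1))) (by positivity)
  rw [dist_eq_norm] at hd
  obtain ⟨N, hN⟩ := Metric.tendsto_atTop.1 (hspan H' hH') (δ / 3) (by positivity)
  refine ⟨N, fun L hL => ?_⟩
  have h1 := norm_integral_mul_comp_sub_le hw H H' (continuous_lacunaryMap ξ L n)
  have h2 := hN L hL
  have h3 : ‖(∫ t, w t) * (∫ θ, H' θ ∂torusMeasure n) - (∫ t, w t) * ∫ θ, H θ ∂torusMeasure n‖ ≤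
      W * ‖H - H'‖ := by
    rw [← mul_sub, norm_mul, norm_sub_rev H]
    gcongr
    · exact norm_integral_le_integral_norm _
    · exact norm_integral_torusMeasure_sub_le _ _
  have h4 : W * ‖H - H'‖ < δ / 3 := by
    calc W * ‖H - H'‖ ≤ (W + 1) * ‖H - H'‖ := by gcongr; linarith
      _ < (W + 1) * (δ / (3 * (W + 1))) := by gcongr
      _ = δ / 3 := by field_simp
  rw [dist_eq_norm] at h2 ⊢
  have := norm_add₃_le (a := (∫ t, w t * H (lacunaryMap ξ L n t)) - ∫ t, w t * H' (lacunaryMap ξ L n t))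
    (b := (∫ t, w t * H' (lacunaryMap ξ L n t)) - (∫ t, w t) * (∫ θ, H' θ ∂torusMeasure n))
    (c := (∫ t, w t) * (∫ θ, H' θ ∂torusMeasure n) - (∫ t, w t) * ∫ θ, H θ ∂torusMeasure n)
  rw [sub_add_sub_cancel, sub_add_sub_cancel] at this
  linarith

end Equidistribution

/-! ### The multiplier on modulated bump functions. -/

namespace RCLike

variable {𝕜 : Type*} [RCLike 𝕜]

/-- This lets real and complex scalars be treated at once: on a real-valued function, multiplication
by a scalar of `𝕜` may be computed in `ℂ`. -/
lemma map_complex_map_mul_ofReal (z : 𝕜) (r : ℝ) :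
    RCLike.map ℂ 𝕜 (RCLike.map 𝕜 ℂ z * (r : ℂ)) = z * (r : 𝕜) := by
  rw [← RCLike.re_add_im z]
  apply RCLike.ext
  · simp
  · simp [mul_right_comm _ r, RCLike.I_im]

lemma norm_map_complex_le (z : ℂ) : ‖RCLike.map ℂ 𝕜 z‖ ≤ ‖z‖ := by
  rw [← sq_le_sq₀ (norm_nonneg _) (norm_nonneg _), ← RCLike.normSq_eq_def', ← RCLike.normSq_eq_def',
    RCLike.normSq_apply, RCLike.normSq_apply]
  obtain h | h := RCLike.I_eq_zero_or_im_I_eq_one (K := 𝕜)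
  · simp [h, mul_self_nonneg]
  · simp [h]

end RCLike

/-- The real function `t ↦ φ t * Re (a * exp (2πi⟪v, t⟫))`. -/
def modulation {V : Type*} [NormedAddCommGroup V] [InnerProductSpace ℝ V]
    (φ : V → ℝ) (a : ℂ) (v t : V) : ℝ :=
  φ t * (a * (Real.fourierChar (inner ℝ v t) : ℂ)).re

lemma contDiff_modulation {V : Type*} [NormedAddCommGroup V] [InnerProductSpace ℝ V] {φ : V → ℝ} (hφ : ContDiff ℝ (⊤ : ℕ∞) φ) (a : ℂ) (v : V) :
    ContDiff ℝ (⊤ : ℕ∞) (modulation φ a v) := by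
  have : modulation φ a v = fun t => φ t * (a.re * Real.cos (2 * Real.pi * inner ℝ v t) -
      a.im * Real.sin (2 * Real.pi * inner ℝ v t)) := by
    ext t
    rw [modulation, Complex.mul_re, Real.fourierChar_apply, Complex.exp_ofReal_mul_I_re,
      Complex.exp_ofReal_mul_I_im]
  rw [this]
  have h : ContDiff ℝ (⊤ : ℕ∞) fun t => 2 * Real.pi * inner ℝ v t :=
    contDiff_const.mul (contDiff_const.inner ℝ contDiff_id)
  exact hφ.mul ((contDiff_const.mul (Real.contDiff_cos.comp h)).sub
    (contDiff_const.mul (Real.contDiff_sin.comp h)))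

section Schwartz

variable {V : Type*} [NormedAddCommGroup V] [InnerProductSpace ℝ V] [FiniteDimensional ℝ V]
  [MeasurableSpace V] [BorelSpace V]

lemma integrable_mul_fourier {M : V → ℂ} (hM : Measurable M) {B : ℝ} (hB : ∀ x, ‖M x‖ ≤ B)
    (f : 𝓢(V, ℂ)) : Integrable fun ξ => M ξ * 𝓕 (f : V → ℂ) ξ := by
  rw [← SchwartzMap.fourier_coe]
  exact (SchwartzMap.integrable _).bdd_mul hM.aestronglyMeasurable (ae_of_all _ hB)

lemma continuous_fourierInv_of_integrable {g : V → ℂ} (hg : Integrable g) : Continuous (𝓕⁻ g) := by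
  have : 𝓕⁻ g = fun t => ∫ ξ, Real.fourierChar (inner ℝ ξ t) • g ξ := by
    ext t; exact Real.fourierInv_eq _ _
  rw [this]
  refine continuous_of_dominated (bound := fun ξ => ‖g ξ‖) (fun t => ?_) (fun t => ?_) hg.norm ?_
  · refine AEStronglyMeasurable.smul ?_ hg.aestronglyMeasurable
    have h : Continuous fun ξ : V => Real.fourierChar (inner ℝ ξ t) :=
      Real.continuous_fourierChar.comp (continuous_id.inner continuous_const)
    exact (continuous_subtype_val.comp h).aestronglyMeasurable
  · exact ae_of_all _ fun ξ => by simp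
  · exact ae_of_all _ fun ξ => by
      exact (Real.continuous_fourierChar.comp
        (continuous_const.inner continuous_id)).smul continuous_const

/-- By Fourier inversion the difference is the inverse transform of `(M - c) * 𝓕 f`, and the sup
norm of an inverse transform is at most the `L¹` norm. -/
lemma norm_fourierInv_mul_fourier_sub_le {M : V → ℂ} (hM : Measurable M) {B : ℝ}
    (hB : ∀ x, ‖M x‖ ≤ B) (f : 𝓢(V, ℂ)) (c : ℂ) (t : V) :
    ‖𝓕⁻ (fun ξ => M ξ * 𝓕 (f : V → ℂ) ξ) t - c * f t‖ ≤
      ∫ ξ, ‖M ξ - c‖ * ‖𝓕 (f : V → ℂ) ξ‖ := by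
  have hF : Integrable (𝓕 (f : V → ℂ)) := by
    rw [← SchwartzMap.fourier_coe]; exact SchwartzMap.integrable _
  have h1 : f t = 𝓕⁻ (𝓕 (f : V → ℂ)) t := by
    rw [f.continuous.fourierInv_fourier_eq f.integrable hF]
  have hi := integrable_mul_fourier hM hB f
  rw [h1, Real.fourierInv_eq, Real.fourierInv_eq, ← integral_const_mul, ← integral_sub]
  · refine (norm_integral_le_integral_norm _).trans_eq ?_
    congr 1 with ξ
    have : Real.fourierChar (inner ℝ ξ t) • (M ξ * 𝓕 (f : V → ℂ) ξ) -
        c * Real.fourierChar (inner ℝ ξ t) • 𝓕 (f : V → ℂ) ξ =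
        Real.fourierChar (inner ℝ ξ t) • ((M ξ - c) * 𝓕 (f : V → ℂ) ξ) := by
      simp only [Circle.smul_def, smul_eq_mul]
      ring
    rw [this, Circle.norm_smul, norm_mul]
  · exact (Real.fourierIntegral_convergent_iff (-t)).2 hi |>.congr (by simp)
  · exact ((Real.fourierIntegral_convergent_iff (-t)).2 hF |>.congr (by simp)).const_mul c

/-- Writing the real part as half the sum with the conjugate, the transform becomes two copies of
that of `φ`, centred at `v` and `-v`. The factor one half is discarded. -/
lemma norm_fourier_modulation_le {φ : V → ℝ} (hφ : Integrable φ) (a : ℂ) (v ξ : V) :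
    ‖𝓕 (fun t => (modulation φ a v t : ℂ)) ξ‖ ≤
      ‖a‖ * (‖𝓕 (fun t => (φ t : ℂ)) (ξ - v)‖ + ‖𝓕 (fun t => (φ t : ℂ)) (ξ + v)‖) := by
  have hi : ∀ η : V, Integrable fun t => Real.fourierChar (-inner ℝ t η) • (φ t : ℂ) := fun η =>
    (Real.fourierIntegral_convergent_iff η).2 hφ.ofReal
  have : 𝓕 (fun t => (modulation φ a v t : ℂ)) ξ =
      a / 2 * 𝓕 (fun t => (φ t : ℂ)) (ξ - v) +
      (starRingEnd ℂ a) / 2 * 𝓕 (fun t => (φ t : ℂ)) (ξ + v) := by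
    rw [Real.fourier_eq, Real.fourier_eq, Real.fourier_eq, ← integral_const_mul,
      ← integral_const_mul, ← integral_add ((hi _).const_mul _) ((hi _).const_mul _)]
    congr 1 with t
    have hre : ((a * (Real.fourierChar (inner ℝ v t) : ℂ)).re : ℂ) =
        a / 2 * (Real.fourierChar (inner ℝ v t) : ℂ) +
        (starRingEnd ℂ a) / 2 * (Real.fourierChar (-inner ℝ v t) : ℂ) := by
      rw [Complex.re_eq_add_conj, map_mul, AddChar.map_neg_eq_inv, Circle.coe_inv_eq_conj]
      ring
    have h1 : -inner ℝ t (ξ - v) = -inner ℝ t ξ + inner ℝ v t := by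
      rw [inner_sub_right, real_inner_comm v t]; ring
    have h2 : -inner ℝ t (ξ + v) = -inner ℝ t ξ + -inner ℝ v t := by
      rw [inner_add_right, real_inner_comm v t]; ring
    simp only [modulation, Circle.smul_def, smul_eq_mul, Complex.ofReal_mul, hre, h1, h2,
      AddChar.map_add_eq_mul, Circle.coe_mul]
    ring
  rw [this]
  refine (norm_add_le _ _).trans ?_
  simp only [norm_mul, norm_div, RCLike.norm_conj, mul_add]
  have h2 : ‖a‖ / ‖(2 : ℂ)‖ ≤ ‖a‖ := by
    simp only [Complex.norm_ofNat]; linarith [norm_nonneg a]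
  gcongr

/-- Translation moves both copies of `ψ` back to the origin, evenness turns the copy at `-v L` into
one at `v L`, and dominated convergence applies because `M` is bounded. -/
lemma tendsto_integral_norm_sub_mul {M : V → ℂ} (hM : Measurable M) {B : ℝ}
    (hB : ∀ x, ‖M x‖ ≤ B) (heven : ∀ x, M (-x) = M x) {ψ : V → ℂ} (hψ : Integrable ψ) {c : ℂ}
    {v : ℕ → V} (hv : ∀ η, Tendsto (fun L => M (v L + η)) atTop (𝓝 c)) :
    Tendsto (fun L => ∫ ξ, ‖M ξ - c‖ * (‖ψ (ξ - v L)‖ + ‖ψ (ξ + v L)‖)) atTop (𝓝 0) := by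
  have hi : ∀ (ψ : V → ℂ), Integrable ψ → Integrable (fun ξ => ‖M ξ - c‖ * ‖ψ ξ‖) := by
    intro ψ hψ
    refine hψ.norm.bdd_mul (c := B + ‖c‖) (hM.sub_const c).norm.aestronglyMeasurable
      (ae_of_all _ fun x => ?_)
    rw [norm_norm]
    exact (norm_sub_le _ _).trans (by gcongr; exact hB x)
  have heq : ∀ L, ∫ ξ, ‖M ξ - c‖ * (‖ψ (ξ - v L)‖ + ‖ψ (ξ + v L)‖) =
      ∫ η, (‖M (v L + η) - c‖ * ‖ψ η‖ + ‖M (v L + -η) - c‖ * ‖ψ η‖) := by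
    intro L
    have e1 : ∫ ξ, ‖M ξ - c‖ * ‖ψ (ξ - v L)‖ = ∫ η, ‖M (v L + η) - c‖ * ‖ψ η‖ := by
      rw [← integral_add_right_eq_self (fun ξ => ‖M ξ - c‖ * ‖ψ (ξ - v L)‖) (v L)]
      simp [add_comm]
    have e2 : ∫ ξ, ‖M ξ - c‖ * ‖ψ (ξ + v L)‖ = ∫ η, ‖M (v L + -η) - c‖ * ‖ψ η‖ := by
      rw [← integral_sub_right_eq_self (fun ξ => ‖M ξ - c‖ * ‖ψ (ξ + v L)‖) (v L)]
      congr 1 with η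
      rw [← heven (v L + -η)]
      simp [add_comm, sub_eq_add_neg]
    rw [integral_add, ← e1, ← e2, ← integral_add]
    · simp only [mul_add]
    · exact hi _ (hψ.comp_sub_right _)
    · exact hi _ (hψ.comp_add_right _)
    · have := (hi _ (hψ.comp_sub_right (v L))).comp_add_right (v L)
      simpa [add_comm] using this
    · have := (hi _ (hψ.comp_add_right (v L))).comp_sub_right (v L)
      refine this.congr (ae_of_all _ fun η => ?_)
      simp only [sub_add_cancel]
      rw [← heven (v L + -η)]
      simp [sub_eq_add_neg]
  simp only [heq]
  have hb : ∀ x, ‖M x - c‖ ≤ B + ‖c‖ := fun x =>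
    (norm_sub_le _ _).trans (by gcongr; exact hB x)
  have h0 : (0 : ℝ) = ∫ _ : V, (0 : ℝ) := by simp
  rw [h0]
  refine tendsto_integral_of_dominated_convergence
    (fun η => (B + ‖c‖) * ‖ψ η‖ + (B + ‖c‖) * ‖ψ η‖) (fun L => ?_) ?_ (fun L => ?_) ?_
  · have m1 : Measurable fun η => ‖M (v L + η) - c‖ :=
      ((hM.comp (measurable_const_add _)).sub_const c).norm
    have m2 : Measurable fun η => ‖M (v L + -η) - c‖ :=
      ((hM.comp (measurable_neg.const_add _)).sub_const c).norm
    exact (m1.aestronglyMeasurable.mul hψ.norm.aestronglyMeasurable).add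
      (m2.aestronglyMeasurable.mul hψ.norm.aestronglyMeasurable)
  · exact (hψ.norm.const_mul _).add (hψ.norm.const_mul _)
  · refine ae_of_all _ fun η => ?_
    rw [Real.norm_of_nonneg (by positivity)]
    gcongr <;> exact hb _
  · refine ae_of_all _ fun η => ?_
    have h1 : ∀ η, Tendsto (fun L => ‖M (v L + η) - c‖ * ‖ψ η‖) atTop (𝓝 0) := fun η => by
      have := ((hv η).sub_const c).norm.mul_const ‖ψ η‖
      simpa using this
    have h2 : Tendsto (fun L => ‖M (v L + -η) - c‖ * ‖ψ η‖) atTop (𝓝 0) := by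
      have := ((hv (-η)).sub_const c).norm.mul_const ‖ψ η‖
      simpa using this
    simpa using (h1 η).add h2

end Schwartz

section Symbol

variable {𝕜 : Type*} [RCLike 𝕜] {d : ℕ} {m : EuclideanSpace ℝ (Fin d) → 𝕜}

lemma exists_bound_of_homogeneous {V : Type*} [NormedAddCommGroup V] [InnerProductSpace ℝ V]
    [FiniteDimensional ℝ V] {m : V → 𝕜} (hhom : ∀ c : ℝ, 0 < c → ∀ x, m (c • x) = m x)
    (hcont : ContinuousOn m {0}ᶜ) : ∃ B, ∀ x, ‖m x‖ ≤ B := by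
  have : ProperSpace V := FiniteDimensional.proper_real V
  obtain ⟨B, hB⟩ := (isCompact_sphere (0 : V) 1).exists_bound_of_continuousOn
    (hcont.mono fun x hx => by
      rintro rfl
      simp at hx)
  refine ⟨max B ‖m 0‖, fun x => ?_⟩
  by_cases hx : x = 0
  · subst hx; exact le_max_right _ _
  · refine le_trans ?_ (le_max_left _ _)
    rw [← hhom ‖x‖⁻¹ (by positivity) x]
    refine hB _ ?_
    simp [norm_smul, hx]

lemma scalarMultiplier_eq (hhom : ∀ c : ℝ, 0 < c → ∀ x, m (c • x) = m x)
    (f : 𝓢(EuclideanSpace ℝ (Fin d), 𝕜)) (t : EuclideanSpace ℝ (Fin d)) :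
    scalarMultiplier m f t = RCLike.map ℂ 𝕜 (𝓕⁻ (fun ξ : EuclideanSpace ℝ (Fin d) =>
      RCLike.map 𝕜 ℂ (m ξ) * 𝓕 (fun s : EuclideanSpace ℝ (Fin d) => RCLike.map 𝕜 ℂ (f s)) ξ) t) := by
  simp only [scalarMultiplier, hhom _ Real.two_pi_pos]

lemma measurable_map_complex (hcont : ContinuousOn m {0}ᶜ) :
    Measurable fun x => RCLike.map 𝕜 ℂ (m x) := by
  refine measurable_of_continuousOn_compl_singleton 0 ?_
  exact (RCLike.map 𝕜 ℂ).continuous.comp_continuousOn hcont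

lemma exists_bound_map_complex (hhom : ∀ c : ℝ, 0 < c → ∀ x, m (c • x) = m x)
    (hcont : ContinuousOn m {0}ᶜ) : ∃ B, ∀ x, ‖RCLike.map 𝕜 ℂ (m x)‖ ≤ B := by
  obtain ⟨B, hB⟩ := exists_bound_of_homogeneous hhom hcont
  exact ⟨‖RCLike.map 𝕜 ℂ‖ * B, fun x => (ContinuousLinearMap.le_opNorm _ _).trans (by
    gcongr; exact hB x)⟩

lemma continuous_scalarMultiplier (hhom : ∀ c : ℝ, 0 < c → ∀ x, m (c • x) = m x)
    (hcont : ContinuousOn m {0}ᶜ) (f : 𝓢(EuclideanSpace ℝ (Fin d), 𝕜)) :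
    Continuous (scalarMultiplier m f) := by
  have : scalarMultiplier m f = _ := funext fun t => scalarMultiplier_eq hhom f t
  rw [this]
  obtain ⟨B, hB⟩ := exists_bound_map_complex hhom hcont
  refine (RCLike.map ℂ 𝕜).continuous.comp (continuous_fourierInv_of_integrable ?_)
  exact integrable_mul_fourier (measurable_map_complex hcont) hB
    (SchwartzMap.postcompCLM (𝕜 := ℝ) (RCLike.map 𝕜 ℂ) f)

lemma RCLike.contDiff_ofReal (𝕜 : Type*) [RCLike 𝕜] {n : WithTop ℕ∞} :
    ContDiff ℝ n (fun r : ℝ => (r : 𝕜)) :=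
  (RCLike.ofRealCLM (K := 𝕜)).contDiff

/-- The function `modulation φ a v` as a Schwartz function with values in `𝕜`. -/
def schwartzModulation (𝕜 : Type*) [RCLike 𝕜] {V : Type*} [NormedAddCommGroup V]
    [InnerProductSpace ℝ V] {φ : V → ℝ} (hφ : ContDiff ℝ (⊤ : ℕ∞) φ)
    (hc : HasCompactSupport φ) (a : ℂ) (v : V) : 𝓢(V, 𝕜) :=
  HasCompactSupport.toSchwartzMap (f := fun t => ((modulation φ a v t : ℝ) : 𝕜))
    ((hc.mul_right (f' := fun t => (a * (Real.fourierChar (inner ℝ v t) : ℂ)).re)).comp_left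
      (g := fun r : ℝ => (r : 𝕜)) (by simp))
    ((RCLike.contDiff_ofReal 𝕜).comp (contDiff_modulation hφ a v))

/-- The approximate eigenvalue property: the transform of the modulated bump concentrates near plus
and minus the lacunary frequency, where the symbol is nearly `m (ξ i)`. The error `δ L` is uniform
in `t`. -/
lemma exists_tendsto_norm_scalarMultiplier_sub_le
    (heven : ∀ x, m (-x) = m x) (hhom : ∀ c : ℝ, 0 < c → ∀ x, m (c • x) = m x)
    (hcont : ContinuousOn m {0}ᶜ) {φ : EuclideanSpace ℝ (Fin d) → ℝ}
    (hφ : ContDiff ℝ (⊤ : ℕ∞) φ) (hc : HasCompactSupport φ)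
    {ξ : ℕ → EuclideanSpace ℝ (Fin d)} {n : ℕ} {k : Fin n → ℤ} {i : Fin n}
    (hξ : ξ i ≠ 0) (hki : k i ≠ 0) (hk : ∀ j, i < j → k j = 0) (a : ℂ) :
    ∃ δ : ℕ → ℝ, Tendsto δ atTop (𝓝 0) ∧ ∀ L t,
      ‖scalarMultiplier m (schwartzModulation 𝕜 hφ hc a (lacunaryFreq ξ L k)) t -
        m (ξ i) * (modulation φ a (lacunaryFreq ξ L k) t : 𝕜)‖ ≤ δ L := by
  set M : EuclideanSpace ℝ (Fin d) → ℂ := fun x => RCLike.map 𝕜 ℂ (m x) with hMdef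
  have hM : Measurable M := measurable_map_complex hcont
  obtain ⟨B, hB⟩ := exists_bound_map_complex hhom hcont
  have hφi : Integrable φ := hφ.continuous.integrable_of_hasCompactSupport hc
  set φC : 𝓢(EuclideanSpace ℝ (Fin d), ℂ) := HasCompactSupport.toSchwartzMap
    (f := fun t => ((φ t : ℝ) : ℂ)) (hc.comp_left (g := fun r : ℝ => (r : ℂ)) (by simp))
    (Complex.ofRealCLM.contDiff.comp hφ) with hφC
  set ψ := 𝓕 (fun t => (φ t : ℂ)) with hψ
  have hψi : Integrable ψ := by
    have : ψ = 𝓕 (φC : EuclideanSpace ℝ (Fin d) → ℂ) := rfl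
    rw [this, ← SchwartzMap.fourier_coe]
    exact SchwartzMap.integrable _
  have hMe : ∀ x, M (-x) = M x := fun x => by simp only [hMdef, heven]
  have hlim := tendsto_integral_norm_sub_mul hM hB hMe hψi
    (tendsto_symbol_lacunaryFreq hMe (fun c hc x => by simp only [hMdef, hhom c hc])
      ((RCLike.map 𝕜 ℂ).continuous.comp_continuousOn hcont) ξ k i hξ hki hk)
  refine ⟨_, by simpa using hlim.const_mul ‖a‖, fun L t => ?_⟩
  set v := lacunaryFreq ξ L k
  have hmap : (fun s => RCLike.map 𝕜 ℂ (schwartzModulation 𝕜 hφ hc a v s)) =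
      (schwartzModulation ℂ hφ hc a v : EuclideanSpace ℝ (Fin d) → ℂ) := by
    ext s
    change RCLike.map 𝕜 ℂ ((modulation φ a v s : ℝ) : 𝕜) = ((modulation φ a v s : ℝ) : ℂ)
    simp
  have h0 : (schwartzModulation ℂ hφ hc a v : EuclideanSpace ℝ (Fin d) → ℂ) =
      fun t => (modulation φ a v t : ℂ) := rfl
  rw [scalarMultiplier_eq hhom, ← RCLike.map_complex_map_mul_ofReal, ← map_sub, hmap]
  refine (RCLike.norm_map_complex_le _).trans ?_
  refine (norm_fourierInv_mul_fourier_sub_le hM hB (schwartzModulation ℂ hφ hc a v) (M (ξ i)) t).trans ?_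
  rw [← integral_const_mul]
  have hbd : ∀ x, ‖M x - M (ξ i)‖ ≤ B + B := fun x =>
    (norm_sub_le _ _).trans (add_le_add (hB x) (hB _))
  have hm : AEStronglyMeasurable (fun x => ‖M x - M (ξ i)‖) :=
    (hM.sub_const (M (ξ i))).norm.aestronglyMeasurable
  refine integral_mono ?_ ?_ fun x => ?_
  · refine Integrable.bdd_mul (c := B + B) ?_ hm (ae_of_all _ fun x => by
      rw [norm_norm]; exact hbd x)
    rw [← SchwartzMap.fourier_coe]
    exact (SchwartzMap.integrable _).norm
  · refine Integrable.const_mul (Integrable.bdd_mul (c := B + B) ?_ hm (ae_of_all _ fun x => by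
      rw [norm_norm]; exact hbd x)) _
    exact (hψi.comp_sub_right _).norm.add (hψi.comp_add_right _).norm
  · calc _ ≤ ‖M x - M (ξ i)‖ * (‖a‖ * (‖ψ (x - v)‖ + ‖ψ (x + v)‖)) := by
          gcongr
          rw [h0]
          exact norm_fourier_modulation_le hφi a v x
      _ = _ := by ring

end Symbol

/-! ### Transference from Euclidean space to trigonometric polynomials on the torus. -/

/-- Pairs `(G, S)` of trigonometric polynomials on the torus with values in `X`, where `S` arises
from `G` by multiplying each term whose frequency has top index `i` by `c i`. -/
def trigPairs {𝕜 : Type*} [RCLike 𝕜] (X : Type*) [NormedAddCommGroup X] [NormedSpace 𝕜 X]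
    (c : ℕ → 𝕜) (n : ℕ) :
    AddSubmonoid ((UnitAddTorus (Fin n) → X) × (UnitAddTorus (Fin n) → X)) :=
  AddSubmonoid.closure {P | ∃ (a : ℂ) (k : Fin n → ℤ) (i : Fin n) (x : X),
    k i ≠ 0 ∧ (∀ j, i < j → k j = 0) ∧
    P = (fun θ => (((a * mFourier k θ).re : ℝ) : 𝕜) • x,
      fun θ => c i • (((a * mFourier k θ).re : ℝ) : 𝕜) • x)}

section

variable {𝕜 : Type*} [RCLike 𝕜] {X : Type*} [NormedAddCommGroup X] [NormedSpace 𝕜 X]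

lemma continuous_of_mem_trigPairs {c : ℕ → 𝕜} {n : ℕ}
    {P : (UnitAddTorus (Fin n) → X) × (UnitAddTorus (Fin n) → X)} (hP : P ∈ trigPairs X c n) :
    Continuous P.1 ∧ Continuous P.2 := by
  induction hP using AddSubmonoid.closure_induction with
  | mem P hP =>
    obtain ⟨a, k, i, x, -, -, rfl⟩ := hP
    have h : Continuous fun θ => (((a * mFourier k θ).re : ℝ) : 𝕜) • x :=
      (RCLike.continuous_ofReal.comp (Complex.continuous_re.comp
        (continuous_const.mul (mFourier k).continuous))).smul continuous_const
    exact ⟨h, h.const_smul (c i)⟩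
  | zero => exact ⟨continuous_const, continuous_const⟩
  | add P Q _ _ hP hQ => exact ⟨hP.1.add hQ.1, hP.2.add hQ.2⟩

/-- Equidistribution, applied with weight `‖φ‖ ^ p` to the continuous function `‖G‖ ^ p`. -/
theorem tendsto_eLpNorm_smul_comp_lacunaryMap {V : Type*} [NormedAddCommGroup V]
    [InnerProductSpace ℝ V] [FiniteDimensional ℝ V] [MeasurableSpace V] [BorelSpace V]
    {ξ : ℕ → V} (hξ : ∀ i, ξ i ≠ 0) {n : ℕ} {φ : V → ℝ} (hφ : Continuous φ)
    (hc : HasCompactSupport φ) {G : UnitAddTorus (Fin n) → X} (hG : Continuous G) {p : ℝ≥0∞}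
    (hp0 : p ≠ 0) (hp : p ≠ ⊤) :
    Tendsto (fun L : ℕ => eLpNorm (fun t => (φ t : 𝕜) • G (lacunaryMap ξ L n t)) p volume) atTop
      (𝓝 (eLpNorm φ p volume * eLpNorm G p (torusMeasure n))) := by
  have hr : 0 < p.toReal := ENNReal.toReal_pos hp0 hp
  have hcont : ∀ L : ℕ, Continuous fun t => (φ t : 𝕜) • G (lacunaryMap ξ L n t) := fun L =>
    (RCLike.continuous_ofReal.comp hφ).smul (hG.comp (continuous_lacunaryMap ξ L n))
  have hcs : ∀ L : ℕ, HasCompactSupport fun t => (φ t : 𝕜) • G (lacunaryMap ξ L n t) := fun L =>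
    (hc.comp_left (g := fun r : ℝ => (r : 𝕜)) (by simp)).smul_right
  have hm1 : ∀ L : ℕ, MemLp (fun t => (φ t : 𝕜) • G (lacunaryMap ξ L n t)) p volume := fun L =>
    (hcont L).memLp_of_hasCompactSupport (hcs L)
  have hm2 : MemLp φ p volume := hφ.memLp_of_hasCompactSupport hc
  obtain ⟨B, hB⟩ := isCompact_univ.exists_bound_of_continuousOn hG.continuousOn
  have hm3 : MemLp G p (torusMeasure n) :=
    MemLp.of_bound hG.aestronglyMeasurable B (ae_of_all _ fun x => hB x trivial)
  simp only [fun L => (hm1 L).eLpNorm_eq_integral_rpow_norm hp0 hp]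
  rw [hm2.eLpNorm_eq_integral_rpow_norm hp0 hp, hm3.eLpNorm_eq_integral_rpow_norm hp0 hp,
    ← ENNReal.ofReal_mul (by positivity), ← Real.mul_rpow (by positivity) (by positivity)]
  refine ENNReal.tendsto_ofReal (Tendsto.rpow_const ?_ (Or.inr (by positivity)))
  set w : V → ℂ := fun t => ((‖φ t‖ ^ p.toReal : ℝ) : ℂ) with hw
  have hwi : Integrable w := (hm2.integrable_norm_rpow hp0 hp).ofReal
  set H : C(UnitAddTorus (Fin n), ℂ) := ⟨fun θ => ((‖G θ‖ ^ p.toReal : ℝ) : ℂ),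
    Complex.continuous_ofReal.comp (hG.norm.rpow_const fun _ => Or.inr hr.le)⟩ with hH
  have h := tendsto_integral_mul_comp_lacunaryMap hξ hwi H
  have h1 : ∀ L : ℕ, ∫ t, w t * H (lacunaryMap ξ L n t) =
      ((∫ t, ‖(φ t : 𝕜) • G (lacunaryMap ξ L n t)‖ ^ p.toReal : ℝ) : ℂ) := by
    intro L
    rw [← integral_complex_ofReal]
    refine integral_congr_ae (ae_of_all _ fun t => ?_)
    simp only [hw, hH, ContinuousMap.coe_mk, norm_smul, RCLike.norm_ofReal, Real.norm_eq_abs]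
    rw [Real.mul_rpow (abs_nonneg _) (norm_nonneg _)]
    simp
  have h2 : (∫ t, w t) * ∫ θ, H θ ∂torusMeasure n =
      (((∫ t, ‖φ t‖ ^ p.toReal) * ∫ θ, ‖G θ‖ ^ p.toReal ∂torusMeasure n : ℝ) : ℂ) := by
    rw [Complex.ofReal_mul, ← integral_complex_ofReal, ← integral_complex_ofReal]
    rfl
  simp only [h1, h2] at h
  have h3 := (Complex.continuous_re.tendsto _).comp h
  simpa only [Function.comp_def, Complex.ofReal_re] using h3

/-- `(G, S)` is realised on `ℝᵈ`: along the lacunary maps, `φ • G` is an element of `𝓢 ⊗ X` whose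
image under the multiplier is uniformly close to `φ • S`. -/
def IsRealized {d : ℕ} (m : EuclideanSpace ℝ (Fin d) → 𝕜) (φ : EuclideanSpace ℝ (Fin d) → ℝ)
    (ξ : ℕ → EuclideanSpace ℝ (Fin d)) {n : ℕ} (G S : UnitAddTorus (Fin n) → X) : Prop :=
  ∃ (K : ℕ) (f : ℕ → Fin K → 𝓢(EuclideanSpace ℝ (Fin d), 𝕜)) (x : Fin K → X) (δ : ℕ → ℝ),
    Tendsto δ atTop (𝓝 0) ∧
    (∀ L t, ∑ k, f L k t • x k = (φ t : 𝕜) • G (lacunaryMap ξ L n t)) ∧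
    ∀ L t, ‖∑ k, scalarMultiplier m (f L k) t • x k - (φ t : 𝕜) • S (lacunaryMap ξ L n t)‖ ≤ δ L

lemma IsRealized.add {d : ℕ} {m : EuclideanSpace ℝ (Fin d) → 𝕜}
    {φ : EuclideanSpace ℝ (Fin d) → ℝ} {ξ : ℕ → EuclideanSpace ℝ (Fin d)} {n : ℕ}
    {G S G' S' : UnitAddTorus (Fin n) → X} (h : IsRealized m φ ξ G S)
    (h' : IsRealized m φ ξ G' S') : IsRealized m φ ξ (G + G') (S + S') := by
  obtain ⟨K, f, x, δ, hδ, h1, h2⟩ := h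
  obtain ⟨K', f', x', δ', hδ', h1', h2'⟩ := h'
  refine ⟨K + K', fun L => Fin.append (f L) (f' L), Fin.append x x', fun L => δ L + δ' L,
    by simpa using hδ.add hδ', fun L t => ?_, fun L t => ?_⟩
  · simp only [Fin.sum_univ_add, Fin.append_left, Fin.append_right, h1, h1', Pi.add_apply, smul_add]
  · simp only [Fin.sum_univ_add, Fin.append_left, Fin.append_right, Pi.add_apply, smul_add]
    rw [add_sub_add_comm]
    exact (norm_add_le _ _).trans (add_le_add (h2 L t) (h2' L t))

lemma isRealized_of_mem_trigPairs {d : ℕ} {m : EuclideanSpace ℝ (Fin d) → 𝕜}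
    (heven : ∀ x, m (-x) = m x) (hhom : ∀ c : ℝ, 0 < c → ∀ x, m (c • x) = m x)
    (hcont : ContinuousOn m {0}ᶜ) {φ : EuclideanSpace ℝ (Fin d) → ℝ}
    (hφ : ContDiff ℝ (⊤ : ℕ∞) φ) (hc : HasCompactSupport φ)
    {ξ : ℕ → EuclideanSpace ℝ (Fin d)} (hξ : ∀ i, ξ i ≠ 0) {n : ℕ}
    {P : (UnitAddTorus (Fin n) → X) × (UnitAddTorus (Fin n) → X)}
    (hP : P ∈ trigPairs X (fun i => m (ξ i)) n) : IsRealized m φ ξ P.1 P.2 := by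
  induction hP using AddSubmonoid.closure_induction with
  | mem P hP =>
    obtain ⟨a, k, i, x, hki, hk, rfl⟩ := hP
    obtain ⟨δ, hδ, h⟩ := exists_tendsto_norm_scalarMultiplier_sub_le heven hhom hcont hφ hc
      (hξ i) hki hk a
    refine ⟨1, fun L _ => schwartzModulation 𝕜 hφ hc a (lacunaryFreq ξ L k), fun _ => x,
      fun L => δ L * ‖x‖, by simpa using hδ.mul_const ‖x‖, fun L t => ?_, fun L t => ?_⟩
    · simp only [Finset.univ_unique, Finset.sum_const, Finset.card_singleton, one_smul,
        mFourier_lacunaryMap, smul_smul]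
      rw [← RCLike.ofReal_mul]
      rfl
    · simp only [Finset.univ_unique, Finset.sum_const, Finset.card_singleton, one_smul,
        mFourier_lacunaryMap, smul_smul]
      rw [← sub_smul, norm_smul]
      gcongr
      have := h L t
      rwa [modulation, RCLike.ofReal_mul, mul_left_comm] at this
  | zero => exact ⟨0, fun _ => Fin.elim0, Fin.elim0, fun _ => 0, tendsto_const_nhds,
      fun L t => by simp, fun L t => by simp⟩
  | add P Q _ _ hP hQ => exact hP.add hQ

/-- The bound for the multiplier is applied to `φ • G` along the lacunary maps. As `L → ∞` both
sides acquire the same factor `‖φ‖_p`, which is positive and finite and cancels. -/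
theorem eLpNorm_le_of_mem_trigPairs {d : ℕ} {m : EuclideanSpace ℝ (Fin d) → 𝕜}
    (heven : ∀ x, m (-x) = m x) (hhom : ∀ c : ℝ, 0 < c → ∀ x, m (c • x) = m x)
    (hcont : ContinuousOn m {0}ᶜ) {p : ℝ≥0∞} (hp1 : 1 ≤ p) (hp : p ≠ ⊤) {C : ℝ≥0∞} (hC : C ≠ ⊤)
    (hm : MultiplierBound X p m C) {ξ : ℕ → EuclideanSpace ℝ (Fin d)} (hξ : ∀ i, ξ i ≠ 0) {n : ℕ}
    {P : (UnitAddTorus (Fin n) → X) × (UnitAddTorus (Fin n) → X)}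
    (hP : P ∈ trigPairs X (fun i => m (ξ i)) n) :
    eLpNorm P.2 p (torusMeasure n) ≤ C * eLpNorm P.1 p (torusMeasure n) := by
  have hp0 : p ≠ 0 := (zero_lt_one.trans_le hp1).ne'
  let b : ContDiffBump (0 : EuclideanSpace ℝ (Fin d)) := default
  have hφ : ContDiff ℝ (⊤ : ℕ∞) b := b.contDiff
  have hc : HasCompactSupport b := b.hasCompactSupport
  obtain ⟨hG, hS⟩ := continuous_of_mem_trigPairs hP
  obtain ⟨K, f, x, δ, hδ, h1, h2⟩ := isRealized_of_mem_trigPairs heven hhom hcont hφ hc hξ hP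
  have hb0 : eLpNorm b p volume ≠ 0 := by
    rw [Ne, eLpNorm_eq_zero_iff b.continuous.aestronglyMeasurable hp0,
      b.continuous.ae_eq_iff_eq volume continuous_zero]
    intro h
    have := b.one_of_mem_closedBall (x := 0) (by simp [b.rIn_pos.le])
    rw [h] at this
    simp at this
  have hbt : eLpNorm b p volume ≠ ⊤ := (b.continuous.memLp_of_hasCompactSupport hc).eLpNorm_ne_top
  have hlimG := tendsto_eLpNorm_smul_comp_lacunaryMap (𝕜 := 𝕜) hξ b.continuous hc hG hp0 hp
  have hlimS := tendsto_eLpNorm_smul_comp_lacunaryMap (𝕜 := 𝕜) hξ b.continuous hc hS hp0 hp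
  -- The error is small uniformly but not known to be small in `L^p` of the whole space. Restriction
  -- to the support of the bump, of finite measure, loses nothing of `φ • S`.
  set W := volume.restrict (tsupport b)
  have hW : W Set.univ ^ p.toReal⁻¹ ≠ ⊤ := by
    refine ENNReal.rpow_ne_top_of_nonneg (by positivity) ?_
    rw [Measure.restrict_apply_univ]
    exact hc.isCompact.measure_ne_top
  have key : ∀ L : ℕ, eLpNorm (fun t => (b t : 𝕜) • P.2 (lacunaryMap ξ L n t)) p volume ≤
      C * eLpNorm (fun t => (b t : 𝕜) • P.1 (lacunaryMap ξ L n t)) p volume +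
        W Set.univ ^ p.toReal⁻¹ * ENNReal.ofReal (δ L) := by
    intro L
    have hT : Continuous fun t => ∑ k, scalarMultiplier m (f L k) t • x k :=
      continuous_finsetSum _ fun k _ =>
        (continuous_scalarMultiplier hhom hcont (f L k)).smul continuous_const
    have hSc : Continuous fun t => (b t : 𝕜) • P.2 (lacunaryMap ξ L n t) :=
      (RCLike.continuous_ofReal.comp b.continuous).smul (hS.comp (continuous_lacunaryMap ξ L n))
    rw [← eLpNorm_restrict_eq_of_support_subset (s := tsupport b)]
    · have : (fun t => (b t : 𝕜) • P.2 (lacunaryMap ξ L n t)) =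
          (fun t => ∑ k, scalarMultiplier m (f L k) t • x k) -
          ((fun t => ∑ k, scalarMultiplier m (f L k) t • x k) -
            fun t => (b t : 𝕜) • P.2 (lacunaryMap ξ L n t)) := by
        simp
      rw [this]
      refine (eLpNorm_sub_le hT.aestronglyMeasurable (hT.sub hSc).aestronglyMeasurable hp1).trans ?_
      refine add_le_add ?_ (eLpNorm_le_of_ae_bound (ae_of_all _ (h2 L)))
      refine (eLpNorm_mono_measure _ Measure.restrict_le_self).trans ?_
      refine (hm K (f L) x).trans_eq ?_
      simp only [h1]
    · intro t ht
      refine subset_tsupport _ fun h0 => ht ?_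
      simp [h0]
  have hlim := le_of_tendsto_of_tendsto' hlimS ((ENNReal.Tendsto.const_mul hlimG (Or.inr hC)).add
    (ENNReal.Tendsto.const_mul (ENNReal.tendsto_ofReal hδ) (Or.inr hW))) key
  rw [ENNReal.ofReal_zero, mul_zero, add_zero, mul_left_comm] at hlim
  exact (ENNReal.mul_le_mul_iff_right hb0 hbt).1 hlim

end

/-! ### Approximation of martingale differences on the torus by trigonometric polynomials. -/

lemma measurePreserving_snoc_torusMeasure (n : ℕ) :
    MeasurePreserving (fun q : UnitAddTorus (Fin n) × UnitAddCircle =>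
      (Fin.snoc q.1 q.2 : UnitAddTorus (Fin (n + 1))))
      ((torusMeasure n).prod AddCircle.haarAddCircle) (torusMeasure (n + 1)) := by
  have h := ((measurePreserving_piFinSuccAbove
    (fun _ : Fin (n + 1) => (AddCircle.haarAddCircle : Measure UnitAddCircle)) (Fin.last n)).symm).comp
    (Measure.measurePreserving_swap (μ := torusMeasure n)
      (ν := (AddCircle.haarAddCircle : Measure UnitAddCircle)))
  change MeasurePreserving _ _ (Measure.pi _)
  convert h using 1
  ext q
  simp [MeasurableEquiv.piFinSuccAbove, Fin.insertNthEquiv]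

lemma measurePreserving_init_torusMeasure (n : ℕ) :
    MeasurePreserving (fun θ : UnitAddTorus (Fin (n + 1)) => (Fin.init θ : UnitAddTorus (Fin n)))
      (torusMeasure (n + 1)) (torusMeasure n) := by
  have hm : Measurable (fun θ : UnitAddTorus (Fin (n + 1)) => (Fin.init θ : UnitAddTorus (Fin n))) :=
    measurable_pi_lambda _ fun i => measurable_pi_apply _
  refine ⟨hm, ?_⟩
  rw [← (measurePreserving_snoc_torusMeasure n).map_eq,
    Measure.map_map hm (measurePreserving_snoc_torusMeasure n).measurable]
  have : (fun θ : UnitAddTorus (Fin (n + 1)) => (Fin.init θ : UnitAddTorus (Fin n))) ∘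
      (fun q : UnitAddTorus (Fin n) × UnitAddCircle =>
        (Fin.snoc q.1 q.2 : UnitAddTorus (Fin (n + 1)))) = Prod.fst := by
    ext q
    simp
  rw [this]
  exact measurePreserving_fst.map_eq

/-- Averaging over a probability space contracts `L^p`: the `L¹` norm of each slice is at most its
`L^p` norm. -/
lemma eLpNorm_integral_prod_right_le {α β X : Type*} {mα : MeasurableSpace α}
    {mβ : MeasurableSpace β} [NormedAddCommGroup X] [NormedSpace ℝ X] {μ : Measure α}
    {ν : Measure β} [IsProbabilityMeasure μ] [IsProbabilityMeasure ν] {p : ℝ≥0∞} (hp1 : 1 ≤ p)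
    (hp : p ≠ ⊤) {F : α × β → X} (hF : AEStronglyMeasurable F (μ.prod ν)) :
    eLpNorm (fun x => ∫ y, F (x, y) ∂ν) p μ ≤ eLpNorm F p (μ.prod ν) := by
  have hp0 : p ≠ 0 := (zero_lt_one.trans_le hp1).ne'
  have hr : 0 < p.toReal := ENNReal.toReal_pos hp0 hp
  rw [eLpNorm_eq_lintegral_rpow_enorm_toReal hp0 hp, eLpNorm_eq_lintegral_rpow_enorm_toReal hp0 hp]
  refine ENNReal.rpow_le_rpow ?_ (by positivity)
  rw [lintegral_prod _ (hF.enorm.pow_const _)]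
  refine lintegral_mono_ae ?_
  filter_upwards [hF.prodMk_left] with x hx
  have h1 : ‖∫ y, F (x, y) ∂ν‖ₑ ≤ eLpNorm (fun y => F (x, y)) p ν := by
    refine (enorm_integral_le_lintegral_enorm _).trans ?_
    rw [← eLpNorm_one_eq_lintegral_enorm]
    exact eLpNorm_le_eLpNorm_of_exponent_le hp1 hx
  calc ‖∫ y, F (x, y) ∂ν‖ₑ ^ p.toReal ≤ (eLpNorm (fun y => F (x, y)) p ν) ^ p.toReal := by gcongr
    _ = _ := by
      rw [eLpNorm_eq_lintegral_rpow_enorm_toReal hp0 hp, ← ENNReal.rpow_mul, one_div,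
        inv_mul_cancel₀ hr.ne', ENNReal.rpow_one]

/-- Trigonometric polynomials on the torus with values in `X`. -/
def trigPolys (𝕜 : Type*) [RCLike 𝕜] (X : Type*) [NormedAddCommGroup X] [NormedSpace 𝕜 X]
    (n : ℕ) : AddSubmonoid (UnitAddTorus (Fin n) → X) :=
  AddSubmonoid.closure {g | ∃ (a : ℂ) (k : Fin n → ℤ) (x : X),
    g = fun θ => (((a * mFourier k θ).re : ℝ) : 𝕜) • x}

section

variable {𝕜 : Type*} [RCLike 𝕜] {X : Type*} [NormedAddCommGroup X] [NormedSpace 𝕜 X]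

lemma continuous_of_mem_trigPolys {n : ℕ} {g : UnitAddTorus (Fin n) → X}
    (hg : g ∈ trigPolys 𝕜 X n) : Continuous g := by
  induction hg using AddSubmonoid.closure_induction with
  | mem g hg =>
    obtain ⟨a, k, x, rfl⟩ := hg
    exact (RCLike.continuous_ofReal.comp (Complex.continuous_re.comp
      (continuous_const.mul (mFourier k).continuous))).smul continuous_const
  | zero => exact continuous_const
  | add g h _ _ hg hh => exact hg.add hh

lemma re_smul_mem_trigPolys {n : ℕ} {H : C(UnitAddTorus (Fin n), ℂ)}
    (hH : H ∈ Submodule.span ℂ (Set.range (mFourier (d := Fin n)))) (a : ℂ) (x : X) :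
    (fun θ => (((a * H θ).re : ℝ) : 𝕜) • x) ∈ trigPolys 𝕜 X n := by
  induction hH using Submodule.span_induction generalizing a with
  | mem H hH =>
    obtain ⟨k, rfl⟩ := hH
    exact AddSubmonoid.subset_closure ⟨a, k, x, rfl⟩
  | zero =>
    convert (trigPolys 𝕜 X n).zero_mem using 1
    ext θ
    simp
  | add H H' _ _ h h' =>
    convert (trigPolys 𝕜 X n).add_mem (h a) (h' a) using 1
    ext θ
    simp only [ContinuousMap.add_apply, mul_add, Complex.add_re, RCLike.ofReal_add, add_smul,
      Pi.add_apply]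
  | smul c H _ h =>
    convert h (a * c) using 1
    ext θ
    simp only [ContinuousMap.smul_apply, smul_eq_mul, mul_assoc]

lemma exists_span_mFourier_eLpNorm_sub_le {n : ℕ} {p : ℝ≥0∞} (hp1 : 1 ≤ p) (hp : p ≠ ⊤)
    {f : UnitAddTorus (Fin n) → ℂ} (hf : MemLp f p (torusMeasure n)) {ε : ℝ≥0∞} (hε : ε ≠ 0) :
    ∃ H ∈ Submodule.span ℂ (Set.range (mFourier (d := Fin n))),
      eLpNorm (f - (H : UnitAddTorus (Fin n) → ℂ)) p (torusMeasure n) ≤ ε := by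
  wlog hεt : ε ≠ ⊤ generalizing ε
  · obtain ⟨H, hH, h⟩ := this one_ne_zero ENNReal.one_ne_top
    exact ⟨H, hH, h.trans (by rw [not_not.1 hεt]; exact le_top)⟩
  have hε2 : ε / 2 ≠ 0 := (ENNReal.half_pos hε).ne'
  obtain ⟨g, hg, hgm⟩ := hf.exists_boundedContinuous_eLpNorm_sub_le hp hε2
  have hcl : g.toContinuousMap ∈ closure (Submodule.span ℂ (Set.range (mFourier (d := Fin n))) :
      Set C(UnitAddTorus (Fin n), ℂ)) := by
    rw [← Submodule.topologicalClosure_coe, span_mFourier_closure_eq_top]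
    trivial
  obtain ⟨H, hH, hd⟩ := Metric.mem_closure_iff.1 hcl (ε / 2).toReal
    (ENNReal.toReal_pos hε2 (ENNReal.div_ne_top hεt (by simp)))
  refine ⟨H, hH, ?_⟩
  have h2 : eLpNorm (g - H : UnitAddTorus (Fin n) → ℂ) p (torusMeasure n) ≤ ε / 2 := by
    refine (eLpNorm_le_of_ae_bound (C := (ε / 2).toReal) (ae_of_all _ fun θ => ?_)).trans ?_
    · rw [dist_eq_norm] at hd
      exact ((g.toContinuousMap - H).norm_coe_le_norm θ).trans hd.le
    · rw [measure_univ, ENNReal.one_rpow, one_mul, ENNReal.ofReal_toReal]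
      exact ENNReal.div_ne_top hεt (by simp)
  have : f - (H : UnitAddTorus (Fin n) → ℂ) = (f - g) + (g - H : UnitAddTorus (Fin n) → ℂ) := by
    simp
  rw [this, ← ENNReal.add_halves ε]
  refine (eLpNorm_add_le (hf.aestronglyMeasurable.sub hgm.aestronglyMeasurable) ?_ hp1).trans
    (add_le_add hg h2)
  exact (g.continuous.sub H.continuous).aestronglyMeasurable

/-- By density of simple functions it suffices to treat `1_s • c`. The indicator is real, so taking
real parts of complex approximants does not increase the error. -/
theorem exists_trigPolys_eLpNorm_sub_le {n : ℕ} {p : ℝ≥0∞} (hp1 : 1 ≤ p) (hp : p ≠ ⊤)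
    {f : UnitAddTorus (Fin n) → X} (hf : MemLp f p (torusMeasure n)) {ε : ℝ≥0∞} (hε : ε ≠ 0) :
    ∃ g, eLpNorm (f - g) p (torusMeasure n) ≤ ε ∧ g ∈ trigPolys 𝕜 X n := by
  refine hf.induction_dense hp _ ?_ (fun f g hf hg => add_mem hf hg)
    (fun f hf => (continuous_of_mem_trigPolys hf).aestronglyMeasurable) hε
  intro c s hs _ ε hε
  have hχ : MemLp (s.indicator fun _ => (1 : ℂ)) p (torusMeasure n) :=
    memLp_indicator_const p hs 1 (Or.inr (measure_ne_top _ _))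
  have hη : ε / (‖c‖ₑ + 1) ≠ 0 := ENNReal.div_ne_zero.2 ⟨hε, by simp⟩
  obtain ⟨H, hH, h⟩ := exists_span_mFourier_eLpNorm_sub_le hp1 hp hχ hη
  refine ⟨fun θ => (((1 * H θ).re : ℝ) : 𝕜) • c, ?_, re_smul_mem_trigPolys hH 1 c⟩
  have hle : ∀ θ, ‖((fun θ => (((1 * H θ).re : ℝ) : 𝕜) • c) - s.indicator fun _ => c) θ‖ ≤
      ‖c‖ * ‖((s.indicator fun _ => (1 : ℂ)) - (H : UnitAddTorus (Fin n) → ℂ)) θ‖ := by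
    intro θ
    have h1 : (s.indicator (fun _ => c) θ : X) =
        ((((s.indicator fun _ => (1 : ℂ)) θ).re : ℝ) : 𝕜) • c := by
      by_cases hθ : θ ∈ s <;> simp [hθ]
    simp only [Pi.sub_apply, h1, one_mul]
    rw [← sub_smul, ← RCLike.ofReal_sub, norm_smul, RCLike.norm_ofReal, mul_comm, ← Complex.sub_re,
      norm_sub_rev]
    gcongr
    exact Complex.abs_re_le_norm _
  refine (eLpNorm_le_mul_eLpNorm_of_ae_le_mul (ae_of_all _ hle) p).trans ?_
  rw [ofReal_norm]
  calc ‖c‖ₑ * _ ≤ (‖c‖ₑ + 1) * (ε / (‖c‖ₑ + 1)) := by gcongr; exact le_self_add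
    _ ≤ ε := ENNReal.mul_div_le

lemma mFourier_snoc {n : ℕ} (k : Fin n → ℤ) (j : ℤ) (θ : UnitAddTorus (Fin n))
    (u : UnitAddCircle) :
    mFourier (Fin.snoc k j : Fin (n + 1) → ℤ) (Fin.snoc θ u : UnitAddTorus (Fin (n + 1))) =
      mFourier k θ * fourier j u := by
  simp [mFourier, Fin.prod_univ_castSucc]

lemma comp_init_mem_trigPairs {c : ℕ → 𝕜} {n : ℕ}
    {P : (UnitAddTorus (Fin n) → X) × (UnitAddTorus (Fin n) → X)} (hP : P ∈ trigPairs X c n) :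
    ((fun θ => P.1 (Fin.init θ), fun θ => P.2 (Fin.init θ)) :
      (UnitAddTorus (Fin (n + 1)) → X) × (UnitAddTorus (Fin (n + 1)) → X)) ∈
        trigPairs X c (n + 1) := by
  induction hP using AddSubmonoid.closure_induction with
  | mem P hP =>
    obtain ⟨a, k, i, x, hki, hk, rfl⟩ := hP
    refine AddSubmonoid.subset_closure ⟨a, Fin.snoc k 0, i.castSucc, x, by simpa using hki, ?_, ?_⟩
    · intro j
      induction j using Fin.lastCases with
      | last => simp
      | cast j => simpa using hk j
    · have h : ∀ θ : UnitAddTorus (Fin (n + 1)), mFourier (Fin.snoc k 0 : Fin (n + 1) → ℤ) θ =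
          mFourier k (Fin.init θ) := fun θ => by
        conv_lhs => rw [← Fin.snoc_init_self θ]
        rw [mFourier_snoc]
        simp
      simp [h]
  | zero => exact (trigPairs X c (n + 1)).zero_mem
  | add P Q _ _ hP hQ => exact (trigPairs X c (n + 1)).add_mem hP hQ

section

variable [NormedSpace ℝ X] [IsScalarTower ℝ 𝕜 X] [CompleteSpace X]

/-- The average of `h` over the last variable. -/
def lastAverage {n : ℕ} (h : UnitAddTorus (Fin (n + 1)) → X) (θ : UnitAddTorus (Fin n)) : X :=
  ∫ u : UnitAddCircle, h (Fin.snoc θ u : UnitAddTorus (Fin (n + 1))) ∂AddCircle.haarAddCircle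

lemma integrable_comp_snoc {n : ℕ} {h : UnitAddTorus (Fin (n + 1)) → X} (hh : Continuous h)
    (θ : UnitAddTorus (Fin n)) : Integrable (fun u : UnitAddCircle =>
      h (Fin.snoc θ u : UnitAddTorus (Fin (n + 1)))) AddCircle.haarAddCircle := by
  have hc : Continuous fun u : UnitAddCircle => h (Fin.snoc θ u : UnitAddTorus (Fin (n + 1))) := by
    refine hh.comp (continuous_pi fun i => ?_)
    induction i using Fin.lastCases with
    | last => simpa using continuous_id'
    | cast i => simpa using continuous_const
  obtain ⟨B, hB⟩ := isCompact_univ.exists_bound_of_continuousOn hc.continuousOn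
  exact Integrable.of_bound hc.aestronglyMeasurable B (ae_of_all _ fun u => hB u trivial)

/-- Subtracting the average removes exactly the terms whose last frequency is zero; every remaining
term has top index `n` and so the coefficient `c n`. -/
lemma sub_lastAverage_mem_trigPairs (c : ℕ → 𝕜) {n : ℕ} {h : UnitAddTorus (Fin (n + 1)) → X}
    (hh : h ∈ trigPolys 𝕜 X (n + 1)) :
    ((fun θ => h θ - lastAverage h (Fin.init θ),
      fun θ => c n • (h θ - lastAverage h (Fin.init θ))) :
      (UnitAddTorus (Fin (n + 1)) → X) × (UnitAddTorus (Fin (n + 1)) → X)) ∈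
        trigPairs X c (n + 1) := by
  induction hh using AddSubmonoid.closure_induction with
  | mem h hh =>
    obtain ⟨a, k, x, rfl⟩ := hh
    have hav : ∀ θ : UnitAddTorus (Fin (n + 1)),
        lastAverage (fun θ => (((a * mFourier k θ).re : ℝ) : 𝕜) • x) (Fin.init θ) =
        if k (Fin.last n) = 0 then (((a * mFourier k θ).re : ℝ) : 𝕜) • x else 0 := by
      intro θ
      have hsn : ∀ u : UnitAddCircle,
          mFourier k (Fin.snoc (Fin.init θ) u : UnitAddTorus (Fin (n + 1))) =
          mFourier (Fin.init k) (Fin.init θ) * fourier (k (Fin.last n)) u := fun u => by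
        conv_lhs => rw [← Fin.snoc_init_self k]
        rw [mFourier_snoc]
      simp only [lastAverage, hsn, ← RCLike.real_smul_eq_coe_smul (K := 𝕜)]
      rw [integral_smul_const]
      split_ifs with h0
      · have hθ : mFourier k θ = mFourier (Fin.init k) (Fin.init θ) := by
          conv_lhs => rw [← Fin.snoc_init_self θ]
          rw [hsn, h0]
          simp
        simp [h0, hθ]
      · have hi : Integrable (fun u : UnitAddCircle => a * (mFourier (Fin.init k) (Fin.init θ) *
            fourier (k (Fin.last n)) u)) AddCircle.haarAddCircle := by
          refine Integrable.const_mul (Integrable.const_mul ?_ _) _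
          exact Integrable.of_bound (fourier _).continuous.aestronglyMeasurable _
            (ae_of_all _ fun u => (fourier (k (Fin.last n))).norm_coe_le_norm u)
        have hre := integral_re hi
        simp only [RCLike.re_eq_complex_re] at hre
        rw [hre, integral_const_mul, integral_const_mul, integral_fourier_haarAddCircle h0]
        simp
    simp only [hav]
    split_ifs with h0
    · convert (trigPairs X c (n + 1)).zero_mem using 1
      ext θ <;> simp
    · refine AddSubmonoid.subset_closure ⟨a, k, Fin.last n, x, h0, fun j hj => ?_, by simp⟩
      exact absurd hj (not_lt.2 (Fin.le_last j))
  | zero =>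
    convert (trigPairs X c (n + 1)).zero_mem using 1
    ext θ <;> simp [lastAverage]
  | add h h' hh hh' h1 h2 =>
    convert (trigPairs X c (n + 1)).add_mem h1 h2 using 1
    have hadd : ∀ θ : UnitAddTorus (Fin n),
        lastAverage (h + h') θ = lastAverage h θ + lastAverage h' θ := fun θ =>
      integral_add (integrable_comp_snoc (continuous_of_mem_trigPolys (𝕜 := 𝕜) hh) θ)
        (integrable_comp_snoc (continuous_of_mem_trigPolys (𝕜 := 𝕜) hh') θ)
    ext θ
    · simp only [hadd, Pi.add_apply, Prod.fst_add]
      abel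
    · simp only [hadd, Pi.add_apply, Prod.snd_add, ← smul_add]
      congr 1
      abel

/-- `(a, b)` is a limit in `L^p` of pairs of trigonometric polynomials in `trigPairs`. -/
def IsTrigLimit (c : ℕ → 𝕜) (p : ℝ≥0∞) (n : ℕ) (a b : UnitAddTorus (Fin n) → X) : Prop :=
  ∀ δ : ℝ≥0∞, δ ≠ 0 → ∃ P ∈ trigPairs X c n, eLpNorm (a - P.1) p (torusMeasure n) ≤ δ ∧
    eLpNorm (b - P.2) p (torusMeasure n) ≤ δ

/-- If `h` is close to `g`, its last average is that of `h - g` and is small by contractivity. One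
`η` pays for `g - h`, the other for recentring `h`. -/
lemma exists_trigPolys_sub_lastAverage_le {n : ℕ} {p : ℝ≥0∞} (hp1 : 1 ≤ p) (hp : p ≠ ⊤)
    {g : UnitAddTorus (Fin (n + 1)) → X} (hg : MemLp g p (torusMeasure (n + 1)))
    (h0 : ∀ᵐ θ ∂torusMeasure n, lastAverage g θ = 0) {η : ℝ≥0∞} (hη : η ≠ 0) :
    ∃ h ∈ trigPolys 𝕜 X (n + 1),
      eLpNorm (fun θ => g θ - (h θ - lastAverage h (Fin.init θ))) p (torusMeasure (n + 1)) ≤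
        η + η := by
  obtain ⟨h, hgh, hh⟩ := exists_trigPolys_eLpNorm_sub_le (𝕜 := 𝕜) hp1 hp hg hη
  refine ⟨h, hh, ?_⟩
  have hhc := continuous_of_mem_trigPolys hh
  have hsn := measurePreserving_snoc_torusMeasure n
  have hgi : Integrable g (torusMeasure (n + 1)) := hg.integrable hp1
  have hgi' : ∀ᵐ θ ∂torusMeasure n, Integrable (fun u : UnitAddCircle =>
      g (Fin.snoc θ u : UnitAddTorus (Fin (n + 1)))) AddCircle.haarAddCircle :=
    (hsn.integrable_comp_of_integrable hgi).prod_right_ae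
  have hav : eLpNorm (lastAverage h) p (torusMeasure n) ≤ η := by
    have hm : AEStronglyMeasurable (h - g) (torusMeasure (n + 1)) :=
      hhc.aestronglyMeasurable.sub hg.aestronglyMeasurable
    have h1 := eLpNorm_integral_prod_right_le hp1 hp (hm.comp_measurePreserving hsn)
    rw [eLpNorm_comp_measurePreserving hm hsn, eLpNorm_sub_comm] at h1
    refine le_trans (le_of_eq (eLpNorm_congr_ae ?_)) (h1.trans hgh)
    filter_upwards [h0, hgi'] with θ hθ hθi
    simp only [Function.comp_apply, Pi.sub_apply]
    rw [integral_sub (integrable_comp_snoc hhc θ) hθi]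
    simp only [lastAverage] at hθ ⊢
    rw [hθ, sub_zero]
  have hsm : StronglyMeasurable (lastAverage h) := by
    have : StronglyMeasurable fun q : UnitAddTorus (Fin n) × UnitAddCircle =>
        h (Fin.snoc q.1 q.2 : UnitAddTorus (Fin (n + 1))) :=
      (hhc.stronglyMeasurable).comp_measurable hsn.measurable
    exact this.integral_prod_right
  have hin := measurePreserving_init_torusMeasure n
  have heq : (fun θ => g θ - (h θ - lastAverage h (Fin.init θ))) =
      (g - h) + lastAverage h ∘ Fin.init := by
    ext θ
    simp only [Pi.add_apply, Pi.sub_apply, Function.comp_apply]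
    abel
  rw [heq]
  refine (eLpNorm_add_le (hg.aestronglyMeasurable.sub hhc.aestronglyMeasurable)
    (hsm.aestronglyMeasurable.comp_measurePreserving hin) hp1).trans (add_le_add hgh ?_)
  rwa [eLpNorm_comp_measurePreserving hsm.aestronglyMeasurable hin]

theorem IsTrigLimit.snoc {c : ℕ → 𝕜} {p : ℝ≥0∞} (hp1 : 1 ≤ p) (hp : p ≠ ⊤) {n : ℕ}
    {a b : UnitAddTorus (Fin n) → X} (hab : IsTrigLimit c p n a b)
    (ha : AEStronglyMeasurable a (torusMeasure n)) (hb : AEStronglyMeasurable b (torusMeasure n))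
    {g : UnitAddTorus (Fin (n + 1)) → X} (hg : MemLp g p (torusMeasure (n + 1)))
    (h0 : ∀ᵐ θ ∂torusMeasure n, lastAverage g θ = 0) :
    IsTrigLimit c p (n + 1) (fun θ => a (Fin.init θ) + g θ)
      (fun θ => b (Fin.init θ) + c n • g θ) := by
  intro δ hδ
  have hδ2 : δ / 2 ≠ 0 := (ENNReal.half_pos hδ).ne'
  -- `K` dominates both `1` and `‖c n‖`, the factors that the new error receives in the two
  -- components. The further halving of the tolerance compensates for `η + η`.
  set K : ℝ≥0∞ := 1 + ‖c n‖ₑ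
  have hη : δ / 2 / K / 2 ≠ 0 := (ENNReal.half_pos (ENNReal.div_ne_zero.2 ⟨hδ2, by
    simp [K]⟩)).ne'
  obtain ⟨P, hP, hP1, hP2⟩ := hab _ hδ2
  obtain ⟨h, hh, hgh⟩ := exists_trigPolys_sub_lastAverage_le (𝕜 := 𝕜) hp1 hp hg h0 hη
  rw [ENNReal.add_halves] at hgh
  have hin := measurePreserving_init_torusMeasure n
  obtain ⟨hPc1, hPc2⟩ := continuous_of_mem_trigPairs hP
  have hQ := sub_lastAverage_mem_trigPairs c hh
  obtain ⟨hQc, -⟩ := continuous_of_mem_trigPairs hQ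
  have hr : AEStronglyMeasurable (fun θ => g θ - (h θ - lastAverage h (Fin.init θ)))
      (torusMeasure (n + 1)) := hg.aestronglyMeasurable.sub hQc.aestronglyMeasurable
  have hK : K * (δ / 2 / K) ≤ δ / 2 := ENNReal.mul_div_le
  refine ⟨_, (trigPairs X c (n + 1)).add_mem (comp_init_mem_trigPairs hP) hQ, ?_, ?_⟩
  · have heq : (fun θ => a (Fin.init θ) + g θ) - ((fun θ => P.1 (Fin.init θ)) +
        fun θ => h θ - lastAverage h (Fin.init θ)) = (a - P.1) ∘ Fin.init +
          fun θ => g θ - (h θ - lastAverage h (Fin.init θ)) := by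
      ext θ
      simp only [Pi.add_apply, Pi.sub_apply, Function.comp_apply]
      abel
    have hm : AEStronglyMeasurable (a - P.1) (torusMeasure n) := ha.sub hPc1.aestronglyMeasurable
    simp only [Prod.fst_add]
    rw [heq, ← ENNReal.add_halves δ]
    refine (eLpNorm_add_le (hm.comp_measurePreserving hin) hr hp1).trans (add_le_add ?_ ?_)
    · rwa [eLpNorm_comp_measurePreserving hm hin]
    · refine (hgh.trans ?_).trans hK
      exact le_mul_of_one_le_left zero_le le_self_add
  · have heq : (fun θ => b (Fin.init θ) + c n • g θ) - ((fun θ => P.2 (Fin.init θ)) +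
        fun θ => c n • (h θ - lastAverage h (Fin.init θ))) = (b - P.2) ∘ Fin.init +
          c n • fun θ => g θ - (h θ - lastAverage h (Fin.init θ)) := by
      ext θ
      simp only [Pi.add_apply, Pi.sub_apply, Function.comp_apply, Pi.smul_apply, smul_sub]
      abel
    have hm : AEStronglyMeasurable (b - P.2) (torusMeasure n) := hb.sub hPc2.aestronglyMeasurable
    simp only [Prod.snd_add]
    rw [heq, ← ENNReal.add_halves δ]
    refine (eLpNorm_add_le (hm.comp_measurePreserving hin) (hr.const_smul _) hp1).trans
      (add_le_add ?_ ?_)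
    · rwa [eLpNorm_comp_measurePreserving hm hin]
    · rw [eLpNorm_const_smul]
      refine le_trans ?_ hK
      gcongr
      exact le_add_self

theorem IsTrigLimit.eLpNorm_le {d : ℕ} {m : EuclideanSpace ℝ (Fin d) → 𝕜}
    (heven : ∀ x, m (-x) = m x) (hhom : ∀ c : ℝ, 0 < c → ∀ x, m (c • x) = m x)
    (hcont : ContinuousOn m {0}ᶜ) {p : ℝ≥0∞} (hp1 : 1 ≤ p) (hp : p ≠ ⊤) {C : ℝ≥0∞} (hC : C ≠ ⊤)
    (hm : MultiplierBound X p m C) {ξ : ℕ → EuclideanSpace ℝ (Fin d)} (hξ : ∀ i, ξ i ≠ 0) {n : ℕ}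
    {a b : UnitAddTorus (Fin n) → X} (hab : IsTrigLimit (fun i => m (ξ i)) p n a b)
    (ha : AEStronglyMeasurable a (torusMeasure n)) (hb : AEStronglyMeasurable b (torusMeasure n)) :
    eLpNorm b p (torusMeasure n) ≤ C * eLpNorm a p (torusMeasure n) := by
  have key : ∀ δ : ℝ≥0∞, δ ≠ 0 → eLpNorm b p (torusMeasure n) ≤
      C * (eLpNorm a p (torusMeasure n) + δ) + δ := by
    intro δ hδ
    obtain ⟨P, hP, h1, h2⟩ := hab δ hδ
    obtain ⟨hc1, hc2⟩ := continuous_of_mem_trigPairs hP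
    have hbP : b = P.2 + (b - P.2) := by simp
    have haP : P.1 = a - (a - P.1) := by simp
    calc eLpNorm b p (torusMeasure n) ≤ eLpNorm P.2 p (torusMeasure n) + δ := by
          conv_lhs => rw [hbP]
          exact (eLpNorm_add_le hc2.aestronglyMeasurable (hb.sub hc2.aestronglyMeasurable) hp1).trans
            (by gcongr)
      _ ≤ C * eLpNorm P.1 p (torusMeasure n) + δ := by
          gcongr
          exact eLpNorm_le_of_mem_trigPairs heven hhom hcont hp1 hp hC hm hξ hP
      _ ≤ _ := by
          gcongr
          conv_lhs => rw [haP]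
          exact (eLpNorm_sub_le ha (ha.sub hc1.aestronglyMeasurable) hp1).trans (by gcongr)
  have hlim : Tendsto (fun δ : ℝ≥0∞ => C * (eLpNorm a p (torusMeasure n) + δ) + δ) (𝓝[>] 0)
      (𝓝 (C * (eLpNorm a p (torusMeasure n) + 0) + 0)) := by
    have hid : Tendsto (fun δ : ℝ≥0∞ => δ) (𝓝[>] 0) (𝓝 0) := tendsto_nhdsWithin_of_tendsto_nhds tendsto_id
    exact (ENNReal.Tendsto.const_mul (tendsto_const_nhds.add hid) (Or.inr hC)).add hid
  rw [add_zero, add_zero] at hlim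
  refine ge_of_tendsto hlim ?_
  filter_upwards [self_mem_nhdsWithin] with δ hδ
  exact key δ (ne_of_gt hδ)

end
end

/-! ### Realisation of the law of a sequence on the torus. -/

lemma exists_map_haarAddCircle_eq_volume :
    ∃ ρ : UnitAddCircle → unitInterval, Measurable ρ ∧ AddCircle.haarAddCircle.map ρ = volume := by
  have h1 : MeasurePreserving (AddCircle.equivIoc (1 : ℝ) 0) AddCircle.haarAddCircle
      (Measure.comap Subtype.val volume) := by
    have := AddCircle.measurePreserving_equivIoc 1 (a := 0)
    rwa [AddCircle.volume_eq_smul_haarAddCircle, ENNReal.ofReal_one, one_smul] at this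
  have h2 : MeasurePreserving (fun u : UnitAddCircle => (AddCircle.equivIoc (1 : ℝ) 0 u : ℝ))
      AddCircle.haarAddCircle (volume.restrict unitInterval) := by
    have := (measurePreserving_subtype_coe (μa := volume) measurableSet_Ioc).comp h1
    rw [restrict_Ioc_eq_restrict_Icc] at this
    have h01 : unitInterval = Set.Icc (0 : ℝ) (0 + 1) := by rw [zero_add]
    rw [h01]
    exact this
  have h3 : Measurable (Set.projIcc (0 : ℝ) 1 zero_le_one) := continuous_projIcc.measurable
  refine ⟨fun u => Set.projIcc 0 1 zero_le_one (AddCircle.equivIoc (1 : ℝ) 0 u : ℝ),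
    h3.comp h2.measurable, ?_⟩
  have h4 := Measure.map_map h3 h2.measurable (μ := AddCircle.haarAddCircle)
  rw [h2.map_eq, ← unitInterval.measurePreserving_coe.map_eq,
    Measure.map_map h3 unitInterval.measurePreserving_coe.measurable] at h4
  have h5 : Set.projIcc (0 : ℝ) 1 zero_le_one ∘ (Subtype.val : unitInterval → ℝ) = id := by
    ext x
    simp
  rw [h5, Measure.map_id] at h4
  exact h4.symm

/-- A Markov kernel into a standard Borel space is represented by a function of its parameter and
of a uniformly distributed point of the circle. -/
lemma exists_measurable_map_haarAddCircle_eq {Z Y : Type*} [MeasurableSpace Z] [MeasurableSpace Y]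
    [StandardBorelSpace Y] [Nonempty Y] (κ : Kernel Z Y) [IsMarkovKernel κ] :
    ∃ f : Z → UnitAddCircle → Y, Measurable (Function.uncurry f) ∧
      ∀ z, AddCircle.haarAddCircle.map (f z) = κ z := by
  obtain ⟨f, hf, hfκ⟩ := κ.exists_measurable_map_eq_unitInterval
  obtain ⟨ρ, hρ, hρv⟩ := exists_map_haarAddCircle_eq_volume
  refine ⟨fun z u => f z (ρ u), hf.comp (measurable_fst.prodMk (hρ.comp measurable_snd)),
    fun z => ?_⟩
  have hfz : Measurable (f z) := hf.comp measurable_prodMk_left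
  rw [← hfκ z, ← hρv, Measure.map_map hfz hρ]
  rfl

lemma map_prod_eq_compProd {Θ U Z Y : Type*} [MeasurableSpace Θ] [MeasurableSpace U]
    [MeasurableSpace Z] [MeasurableSpace Y] {τ : Measure Θ} [IsProbabilityMeasure τ]
    {υ : Measure U} [IsProbabilityMeasure υ] {κ : Kernel Z Y} [IsMarkovKernel κ] {π : Θ → Z}
    (hπ : Measurable π) {f : Z → U → Y} (hf : Measurable (Function.uncurry f))
    (hfκ : ∀ z, υ.map (f z) = κ z) :
    (τ.prod υ).map (fun q => (π q.1, f (π q.1) q.2)) = (τ.map π) ⊗ₘ κ := by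
  have hm : Measurable fun q : Θ × U => (π q.1, f (π q.1) q.2) :=
    (hπ.comp measurable_fst).prodMk
      (hf.comp ((hπ.comp measurable_fst).prodMk measurable_snd))
  have := Measure.isProbabilityMeasure_map (μ := τ) hπ.aemeasurable
  ext s hs
  rw [Measure.map_apply hm hs, Measure.prod_apply (hm hs), Measure.compProd_apply hs,
    lintegral_map (Kernel.measurable_kernel_prodMk_left hs) hπ]
  refine lintegral_congr fun θ => ?_
  have hfz : Measurable (f (π θ)) := hf.comp measurable_prodMk_left
  rw [← hfκ, Measure.map_apply hfz (measurable_prodMk_left hs)]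
  rfl

/-- The sequence that agrees with `y` before time `n` and vanishes from then on. -/
def truncSeq {Y : Type*} [Zero Y] (n : ℕ) (y : ℕ → Y) : ℕ → Y := fun i => if i < n then y i else 0

/-- The sequence of length `n` generated by the updating functions `f` from the coordinates of a
point of the torus. -/
def torusPath {Y : Type*} [Zero Y] (f : ℕ → (ℕ → Y) → UnitAddCircle → Y) :
    (n : ℕ) → UnitAddTorus (Fin n) → ℕ → Y
  | 0, _ => 0
  | n + 1, θ => Function.update (torusPath f n (Fin.init θ)) n
      (f n (torusPath f n (Fin.init θ)) (θ (Fin.last n)))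

section Path

variable {Y : Type*} [Zero Y]

lemma update_truncSeq (n : ℕ) (y : ℕ → Y) :
    Function.update (truncSeq n y) n (y n) = truncSeq (n + 1) y := by
  ext i
  simp only [truncSeq, Function.update_apply]
  split_ifs with h1 h2 h3 h3
  · rw [h1]
  · omega
  · rfl
  · omega
  · omega
  · rfl

variable [MeasurableSpace Y]

lemma measurable_truncSeq (n : ℕ) : Measurable (truncSeq n : (ℕ → Y) → ℕ → Y) := by
  refine measurable_pi_lambda _ fun i => ?_
  by_cases h : i < n
  · simpa [truncSeq, h] using measurable_pi_apply i
  · simp [truncSeq, h]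

lemma measurable_torusPath {f : ℕ → (ℕ → Y) → UnitAddCircle → Y}
    (hf : ∀ n, Measurable (Function.uncurry (f n))) (n : ℕ) : Measurable (torusPath f n) := by
  induction n with
  | zero => exact measurable_const
  | succ n ih =>
    have h1 : Measurable fun θ : UnitAddTorus (Fin (n + 1)) => torusPath f n (Fin.init θ) :=
      ih.comp (measurePreserving_init_torusMeasure n).measurable
    exact measurable_update'.comp
      (h1.prodMk ((hf n).comp (h1.prodMk (measurable_pi_apply (Fin.last n)))))

lemma torusPath_snoc (f : ℕ → (ℕ → Y) → UnitAddCircle → Y) (n : ℕ) (θ : UnitAddTorus (Fin n))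
    (u : UnitAddCircle) :
    torusPath f (n + 1) (Fin.snoc θ u : UnitAddTorus (Fin (n + 1))) =
      Function.update (torusPath f n θ) n (f n (torusPath f n θ) u) := by
  simp [torusPath]

/-- Each fresh coordinate samples the next term from its conditional law given the past, so the law
of past and next term together is again that under `ν`. -/
lemma map_torusPath [StandardBorelSpace Y] [Nonempty Y] {ν : Measure (ℕ → Y)}
    [IsProbabilityMeasure ν] {f : ℕ → (ℕ → Y) → UnitAddCircle → Y}
    (hf : ∀ n, Measurable (Function.uncurry (f n)))
    (hfκ : ∀ n z, AddCircle.haarAddCircle.map (f n z) =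
      condDistrib (fun y : ℕ → Y => y n) (truncSeq n) ν z) (n : ℕ) :
    (torusMeasure n).map (torusPath f n) = ν.map (truncSeq n) := by
  induction n with
  | zero =>
    have h1 : torusPath f 0 = fun _ => 0 := rfl
    have h2 : (truncSeq 0 : (ℕ → Y) → ℕ → Y) = fun _ => 0 := by
      ext y i
      simp [truncSeq]
    rw [h1, h2, Measure.map_const, Measure.map_const]
    simp
  | succ n ih =>
    have hsn := measurePreserving_snoc_torusMeasure n
    have hp := measurable_torusPath hf n
    have hu : Measurable fun q : (ℕ → Y) × Y => Function.update q.1 n q.2 := measurable_update'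
    rw [← hsn.map_eq, Measure.map_map (measurable_torusPath hf (n + 1)) hsn.measurable]
    have h1 : torusPath f (n + 1) ∘ (fun q : UnitAddTorus (Fin n) × UnitAddCircle =>
        (Fin.snoc q.1 q.2 : UnitAddTorus (Fin (n + 1)))) =
        (fun q : (ℕ → Y) × Y => Function.update q.1 n q.2) ∘
          fun q => (torusPath f n q.1, f n (torusPath f n q.1) q.2) := by
      ext1 q
      exact torusPath_snoc f n q.1 q.2
    have hm : Measurable fun q : UnitAddTorus (Fin n) × UnitAddCircle =>
        (torusPath f n q.1, f n (torusPath f n q.1) q.2) :=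
      (hp.comp measurable_fst).prodMk
        ((hf n).comp ((hp.comp measurable_fst).prodMk measurable_snd))
    rw [h1, ← Measure.map_map hu hm, map_prod_eq_compProd hp (hf n) (hfκ n), ih,
      compProd_map_condDistrib (measurable_pi_apply n).aemeasurable,
      Measure.map_map hu ((measurable_truncSeq n).prodMk (measurable_pi_apply n))]
    congr 1
    ext1 y
    exact update_truncSeq n y

end Path

section

variable {𝕜 : Type*} [RCLike 𝕜] {Y : Type*} [NormedAddCommGroup Y] [NormedSpace ℝ Y]
  [NormedSpace 𝕜 Y] [IsScalarTower ℝ 𝕜 Y] [CompleteSpace Y] [MeasurableSpace Y] [BorelSpace Y]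
  [SecondCountableTopology Y]

/-- Vanishing integrals over all events of the past mean that the conditional expectation is zero,
and that expectation is the mean of the conditional law. -/
lemma ae_integral_condDistrib_eq_zero {ν : Measure (ℕ → Y)} [IsProbabilityMeasure ν] {n : ℕ}
    (hi : Integrable (fun y : ℕ → Y => y n) ν)
    (h0 : ∀ s, MeasurableSet s → ∫ y in truncSeq n ⁻¹' s, y n ∂ν = 0) :
    ∀ᵐ z ∂ν.map (truncSeq n),
      ∫ x, x ∂condDistrib (fun y : ℕ → Y => y n) (truncSeq n) ν z = 0 := by
  have hle : MeasurableSpace.comap (truncSeq n) MeasurableSpace.pi ≤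
      (MeasurableSpace.pi : MeasurableSpace (ℕ → Y)) := (measurable_truncSeq n).comap_le
  have h1 := condExp_ae_eq_integral_condDistrib' (measurable_truncSeq n) hi
  have h2 : (fun _ => (0 : Y)) =ᵐ[ν] ν[fun y : ℕ → Y => y n |
      MeasurableSpace.comap (truncSeq n) MeasurableSpace.pi] := by
    refine ae_eq_condExp_of_forall_setIntegral_eq hle hi
      (fun _ _ _ => integrableOn_zero) ?_ aestronglyMeasurable_const
    rintro _ ⟨s, hs, rfl⟩ _
    rw [h0 s hs]
    simp
  have hm : StronglyMeasurable fun z =>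
      ∫ x, x ∂condDistrib (fun y : ℕ → Y => y n) (truncSeq n) ν z :=
    StronglyMeasurable.integral_kernel stronglyMeasurable_id
  rw [ae_map_iff (measurable_truncSeq n).aemeasurable (hm.measurableSet_eq_fun stronglyMeasurable_const)]
  filter_upwards [h1, h2] with y hy1 hy2
  rw [← hy1, ← hy2]

/-- On the torus the `n`-th term depends on the first `n + 1` coordinates and has mean zero in the
last, so the approximation can be built up by `IsTrigLimit.snoc`; norms are preserved because laws
are. -/
theorem eLpNorm_sum_smul_le_of_centered {d : ℕ} {m : EuclideanSpace ℝ (Fin d) → 𝕜}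
    (heven : ∀ x, m (-x) = m x) (hhom : ∀ c : ℝ, 0 < c → ∀ x, m (c • x) = m x)
    (hcont : ContinuousOn m {0}ᶜ) {p : ℝ≥0∞} (hp1 : 1 ≤ p) (hp : p ≠ ⊤) {C : ℝ≥0∞} (hC : C ≠ ⊤)
    (hm : MultiplierBound Y p m C) {ξ : ℕ → EuclideanSpace ℝ (Fin d)} (hξ : ∀ i, ξ i ≠ 0)
    {ν : Measure (ℕ → Y)} [IsProbabilityMeasure ν] (hL : ∀ n, MemLp (fun y : ℕ → Y => y n) p ν)
    (h0 : ∀ n s, MeasurableSet s → ∫ y in truncSeq n ⁻¹' s, y n ∂ν = 0) (N : ℕ) :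
    eLpNorm (fun y : ℕ → Y => ∑ i ∈ Finset.range N, m (ξ i) • y i) p ν ≤
      C * eLpNorm (fun y : ℕ → Y => ∑ i ∈ Finset.range N, y i) p ν := by
  choose f hf hfκ using fun n => exists_measurable_map_haarAddCircle_eq
    (condDistrib (fun y : ℕ → Y => y n) (truncSeq n) ν)
  have hlaw := map_torusPath hf hfκ
  have hpm := measurable_torusPath hf
  have hsum : ∀ (c : ℕ → 𝕜) (n : ℕ),
      Measurable fun y : ℕ → Y => ∑ i ∈ Finset.range n, c i • y i := fun c n =>
    Finset.measurable_fun_sum _ fun i _ => (measurable_pi_apply i).const_smul (c i)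
  have hnorm : ∀ (c : ℕ → 𝕜) (n : ℕ),
      eLpNorm (fun y : ℕ → Y => ∑ i ∈ Finset.range n, c i • y i) p ν =
      eLpNorm (fun θ => ∑ i ∈ Finset.range n, c i • torusPath f n θ i) p (torusMeasure n) := by
    intro c n
    have h1 := eLpNorm_map_measure (p := p) (μ := torusMeasure n)
      (hsum c n).aestronglyMeasurable (hpm n).aemeasurable
    rw [hlaw, eLpNorm_map_measure (hsum c n).aestronglyMeasurable
      (measurable_truncSeq n).aemeasurable] at h1
    refine Eq.trans ?_ h1
    congr 1
    ext1 y
    refine Finset.sum_congr rfl fun i hi => ?_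
    simp [truncSeq, Finset.mem_range.1 hi]
  have hlim : ∀ n, IsTrigLimit (fun i => m (ξ i)) p n
      -- The coefficient `1` makes the plain sum an instance of the facts proved for arbitrary `c`.
      (fun θ => ∑ i ∈ Finset.range n, (1 : 𝕜) • torusPath f n θ i)
      (fun θ => ∑ i ∈ Finset.range n, m (ξ i) • torusPath f n θ i) := by
    intro n
    induction n with
    | zero =>
      intro δ _
      exact ⟨0, zero_mem _, by simp, by simp⟩
    | succ n ih =>
      have hg : MemLp (fun θ => torusPath f (n + 1) θ n) p (torusMeasure (n + 1)) := by
        have h1 : MemLp (fun y : ℕ → Y => y n) p ((torusMeasure (n + 1)).map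
            (torusPath f (n + 1))) := by
          rw [hlaw, memLp_map_measure_iff (measurable_pi_apply n).aestronglyMeasurable
            (measurable_truncSeq _).aemeasurable]
          simpa [Function.comp_def, truncSeq] using hL n
        exact (memLp_map_measure_iff (measurable_pi_apply n).aestronglyMeasurable
          (hpm _).aemeasurable).1 h1
      have hg0 : ∀ᵐ θ ∂torusMeasure n, lastAverage (fun θ => torusPath f (n + 1) θ n) θ = 0 := by
        have h1 := ae_integral_condDistrib_eq_zero ((hL n).integrable hp1) (h0 n)
        rw [← hlaw] at h1
        filter_upwards [ae_of_ae_map (hpm n).aemeasurable h1] with θ hθ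
        have hfz : Measurable (f n (torusPath f n θ)) := (hf n).comp measurable_prodMk_left
        rw [← hfκ, integral_map hfz.aemeasurable
          (f := fun x => x) aestronglyMeasurable_id] at hθ
        simpa [lastAverage, torusPath_snoc] using hθ
      have hmeas : ∀ c : ℕ → 𝕜, AEStronglyMeasurable
          (fun θ => ∑ i ∈ Finset.range n, c i • torusPath f n θ i) (torusMeasure n) := fun c =>
        ((hsum c n).comp (hpm n)).aestronglyMeasurable
      have hstep := ih.snoc hp1 hp (hmeas _) (hmeas _) hg hg0
      have heq : ∀ (c : ℕ → 𝕜) (θ : UnitAddTorus (Fin (n + 1))),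
          ∑ i ∈ Finset.range (n + 1), c i • torusPath f (n + 1) θ i =
          (∑ i ∈ Finset.range n, c i • torusPath f n (Fin.init θ) i) +
            c n • torusPath f (n + 1) θ n := by
        intro c θ
        rw [Finset.sum_range_succ]
        congr 1
        refine Finset.sum_congr rfl fun i hi => ?_
        rw [torusPath, Function.update_of_ne (Finset.mem_range.1 hi).ne]
      rw [funext (heq fun _ => 1), funext (heq fun i => m (ξ i))]
      simpa only [one_smul] using hstep
  have hfin := (hlim N).eLpNorm_le heven hhom hcont hp1 hp hC hm hξ
    ((hsum _ N).comp (hpm N)).aestronglyMeasurable ((hsum _ N).comp (hpm N)).aestronglyMeasurable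
  have h1 := hnorm (fun _ => 1) N
  rw [← h1, ← hnorm (fun i => m (ξ i))] at hfin
  simpa only [one_smul] using hfin

end

/-! ### Symmetrisation and reduction of arbitrary martingales. -/

lemma measurable_truncSeq_comp {Ω Y : Type*} {mΩ : MeasurableSpace Ω} [Zero Y] [MeasurableSpace Y]
    {n : ℕ} {D : Ω → ℕ → Y} (h : ∀ i < n, Measurable fun ω => D ω i) :
    Measurable fun ω => truncSeq n (D ω) := by
  refine measurable_pi_lambda _ fun i => ?_
  by_cases hi : i < n
  · simpa [truncSeq, hi] using h i hi
  · simp [truncSeq, hi]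

section Symmetrize

variable {Ω Y : Type*} [MeasurableSpace Ω] [NormedAddCommGroup Y] [MeasurableSpace Y] [BorelSpace Y]

/-- The law of `r • D`, where `r` is a fair random sign independent of `D`. -/
def symmetrizedLaw (μ : Measure Ω) (D : Ω → ℕ → Y) : Measure (ℕ → Y) :=
  (2⁻¹ : ℝ≥0∞) • (μ.map D + μ.map fun ω n => -D ω n)

variable {μ : Measure Ω} {D : Ω → ℕ → Y}

lemma measurable_neg_seq (hD : Measurable D) : Measurable fun ω n => -D ω n :=
  measurable_pi_lambda _ fun n => (measurable_pi_iff.1 hD n).neg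

lemma isProbabilityMeasure_symmetrizedLaw [IsProbabilityMeasure μ] (hD : Measurable D) :
    IsProbabilityMeasure (symmetrizedLaw μ D) := by
  have h1 := Measure.isProbabilityMeasure_map (μ := μ) hD.aemeasurable
  have h2 := Measure.isProbabilityMeasure_map (μ := μ) (measurable_neg_seq hD).aemeasurable
  refine ⟨?_⟩
  simp [symmetrizedLaw, ENNReal.inv_two_add_inv_two]

lemma eLpNorm_symmetrizedLaw {Z : Type*} [NormedAddCommGroup Z] [MeasurableSpace Z] [BorelSpace Z]
    [SecondCountableTopology Z] (hD : Measurable D) {F : (ℕ → Y) → Z} (hF : Measurable F)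
    (hsymm : ∀ y : ℕ → Y, ‖F (fun n => -y n)‖ = ‖F y‖) {p : ℝ≥0∞} (hp0 : p ≠ 0) (hp : p ≠ ⊤) :
    eLpNorm F p (symmetrizedLaw μ D) = eLpNorm (fun ω => F (D ω)) p μ := by
  rw [eLpNorm_eq_lintegral_rpow_enorm_toReal hp0 hp, eLpNorm_eq_lintegral_rpow_enorm_toReal hp0 hp]
  congr 1
  have hm : Measurable fun y => ‖F y‖ₑ ^ p.toReal := hF.enorm.pow_const _
  rw [symmetrizedLaw, lintegral_smul_measure, lintegral_add_measure, lintegral_map hm hD,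
    lintegral_map hm (measurable_neg_seq hD)]
  have : ∀ ω, ‖F fun n => -D ω n‖ₑ = ‖F (D ω)‖ₑ := fun ω => by
    rw [← ofReal_norm, hsymm, ofReal_norm]
  simp only [this]
  rw [← two_mul, smul_eq_mul, ← mul_assoc, ENNReal.inv_mul_cancel (by simp) (by simp), one_mul]

/-- The two halves of the law contribute the two sides of `h0` with opposite signs. -/
lemma setIntegral_symmetrizedLaw_eq_zero [NormedSpace ℝ Y] [SecondCountableTopology Y]
    (hD : Measurable D) {n : ℕ} (hi : Integrable (fun ω => D ω n) μ) {s : Set (ℕ → Y)}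
    (hs : MeasurableSet s)
    (h0 : ∫ ω in D ⁻¹' s, D ω n ∂μ = ∫ ω in (fun ω n => -D ω n) ⁻¹' s, D ω n ∂μ) :
    ∫ y in s, y n ∂symmetrizedLaw μ D = 0 := by
  have hD' := measurable_neg_seq hD
  have hy : ∀ κ : Measure (ℕ → Y), AEStronglyMeasurable (fun y : ℕ → Y => y n) κ := fun κ =>
    (measurable_pi_apply n).aestronglyMeasurable
  have i1 : Integrable (fun y : ℕ → Y => y n) (μ.map D) :=
    (integrable_map_measure (hy _) hD.aemeasurable).2 hi
  have i2 : Integrable (fun y : ℕ → Y => y n) (μ.map fun ω n => -D ω n) :=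
    (integrable_map_measure (hy _) hD'.aemeasurable).2 hi.neg
  rw [symmetrizedLaw, Measure.restrict_smul, integral_smul_measure, Measure.restrict_add,
    integral_add_measure i1.integrableOn i2.integrableOn, setIntegral_map hs (hy _) hD.aemeasurable,
    setIntegral_map hs (hy _) hD'.aemeasurable, integral_neg, h0]
  simp

end Symmetrize

namespace IsMartingaleDifference

variable {Ω X : Type*} {mΩ : MeasurableSpace Ω} [NormedAddCommGroup X] [NormedSpace ℝ X]
  [CompleteSpace X] {d : ℕ → Ω → X} {ℱ : Filtration ℕ mΩ} {μ : Measure Ω}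

lemma succ_eq_sub (d : ℕ → Ω → X) (n : ℕ) : d (n + 1) =
    (fun ω => ∑ i ∈ Finset.range (n + 1 + 1), d i ω) -
      fun ω => ∑ i ∈ Finset.range (n + 1), d i ω := by
  ext ω
  simp [Finset.sum_range_succ _ (n + 1)]

lemma stronglyMeasurable (h : IsMartingaleDifference d ℱ μ) (n : ℕ) :
    StronglyMeasurable[ℱ n] (d n) := by
  cases n with
  | zero => simpa using h.1 0
  | succ n =>
    rw [succ_eq_sub d n]
    exact (h.1 (n + 1)).sub ((h.1 n).mono (ℱ.mono n.le_succ))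

lemma setIntegral_succ_eq_zero [IsFiniteMeasure μ] (h : IsMartingaleDifference d ℱ μ) {n : ℕ}
    {s : Set Ω} (hs : MeasurableSet[ℱ n] s) : ∫ ω in s, d (n + 1) ω ∂μ = 0 := by
  have h1 := Martingale.setIntegral_eq h n.le_succ hs
  rw [succ_eq_sub d n]
  simp only [Pi.sub_apply]
  rw [integral_sub (h.integrable _).integrableOn (h.integrable _).integrableOn, h1, sub_self]

end IsMartingaleDifference

/-- Needed to replace `X` by a separable subspace, on which conditional distributions exist. -/
lemma MultiplierBound.submodule {𝕜 : Type*} [RCLike 𝕜] {d : ℕ} {X : Type*} [NormedAddCommGroup X]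
    [NormedSpace 𝕜 X] {p : ℝ≥0∞} {m : EuclideanSpace ℝ (Fin d) → 𝕜} {C : ℝ≥0∞}
    (h : MultiplierBound X p m C) (Y : Submodule 𝕜 X) : MultiplierBound Y p m C := by
  intro K f x
  have := h K f fun k => (x k : X)
  have heq : ∀ c : Fin K → EuclideanSpace ℝ (Fin d) → 𝕜,
      eLpNorm (fun t => ∑ k, c k t • x k) p volume =
      eLpNorm (fun t => ∑ k, c k t • (x k : X)) p volume := fun c =>
    eLpNorm_congr_norm_ae (ae_of_all _ fun t => by
      rw [Submodule.coe_norm]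
      simp)
  rwa [heq, heq fun k t => f k t]

section

variable {𝕜 : Type w} [RCLike 𝕜] {X : Type u} [NormedAddCommGroup X] [NormedSpace ℝ X]
  [NormedSpace 𝕜 X] [IsScalarTower ℝ 𝕜 X] [CompleteSpace X]

theorem umdBound_of_multiplierBound {d : ℕ} {m : EuclideanSpace ℝ (Fin d) → 𝕜}
    (heven : ∀ x, m (-x) = m x) (hhom : ∀ c : ℝ, 0 < c → ∀ x, m (c • x) = m x)
    (hcont : ContinuousOn m {0}ᶜ) {p : ℝ≥0∞} (hp1 : 1 ≤ p) (hp : p ≠ ⊤) {C : ℝ≥0∞} (hC : C ≠ ⊤)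
    (hm : MultiplierBound X p m C) : UMDBound.{u, v, w} X p (m '' {0}ᶜ) C := by
  intro Ω mΩ μ _ ℱ D hmart hL N ε hε
  have hp0 : p ≠ 0 := (zero_lt_one.trans_le hp1).ne'
  choose ξ hξ hξε using hε
  -- Strongly measurable functions have separable range, so this closed subspace is complete and
  -- separable, hence standard Borel.
  let Y : Submodule 𝕜 X := (Submodule.span 𝕜 (⋃ n, Set.range (D n))).topologicalClosure
  have hsep : TopologicalSpace.IsSeparable (Y : Set X) := by
    rw [Submodule.topologicalClosure_coe]
    refine (TopologicalSpace.IsSeparable.span ?_).closure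
    exact TopologicalSpace.IsSeparable.iUnion fun n => (hmart.stronglyMeasurable n).isSeparable_range
  have : TopologicalSpace.SeparableSpace Y := hsep.separableSpace
  have : SecondCountableTopology Y := UniformSpace.secondCountable_of_separable Y
  have : CompleteSpace Y := (Submodule.isClosed_topologicalClosure _).completeSpace_coe
  let _ : MeasurableSpace X := borel X
  have : BorelSpace X := ⟨rfl⟩
  have : BorelSpace Y := Subtype.borelSpace (Y : Set X)
  have hDY : ∀ n ω, D n ω ∈ Y := fun n ω =>
    Submodule.le_topologicalClosure _ (Submodule.subset_span (Set.mem_iUnion.2 ⟨n, ω, rfl⟩))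
  let D' : Ω → ℕ → Y := fun ω n => ⟨D n ω, hDY n ω⟩
  have hD'm : ∀ n, Measurable[ℱ n] fun ω => D' ω n := fun n =>
    (hmart.stronglyMeasurable n).measurable.subtype_mk
  have hD' : Measurable D' := measurable_pi_lambda _ fun n => (hD'm n).mono (ℱ.le n) le_rfl
  have hL' : ∀ n, MemLp (fun ω => D' ω n) p μ := fun n =>
    (hL n).mono ((measurable_pi_iff.1 hD' n).aestronglyMeasurable) (ae_of_all _ fun ω => le_rfl)
  have hν := isProbabilityMeasure_symmetrizedLaw (μ := μ) hD'
  have hLν : ∀ n, MemLp (fun y : ℕ → Y => y n) p (symmetrizedLaw μ D') := fun n => by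
    refine ⟨(measurable_pi_apply n).aestronglyMeasurable, ?_⟩
    rw [eLpNorm_symmetrizedLaw hD' (measurable_pi_apply n) (fun y => norm_neg _) hp0 hp]
    exact (hL' n).2
  have h0 : ∀ n s, MeasurableSet s → ∫ y in truncSeq n ⁻¹' s, y n ∂symmetrizedLaw μ D' = 0 := by
    intro n s hs
    refine setIntegral_symmetrizedLaw_eq_zero hD' ((hL' n).integrable hp1)
      (measurable_truncSeq n hs) ?_
    cases n with
    | zero =>
      -- At time `0` the truncated past is constant, so both events coincide and the mean of the
      -- initial term cancels. Later both integrals vanish, because the past of `D'` and that of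
      -- `-D'` are measurable for `ℱ n`.
      congr 2
    | succ n =>
      have hzero : ∀ A, MeasurableSet[ℱ n] A → ∫ ω in A, D' ω (n + 1) ∂μ = 0 := by
        intro A hA
        have h1 := (Y.subtypeL.restrictScalars ℝ).integral_comp_comm
          (((hL' (n + 1)).integrable hp1).integrableOn (s := A))
        have h2 : ∫ ω in A, (Y.subtypeL.restrictScalars ℝ) (D' ω (n + 1)) ∂μ = 0 :=
          hmart.setIntegral_succ_eq_zero hA
        rw [h2] at h1
        exact Subtype.ext h1.symm
      have hi : ∀ i < n + 1, Measurable[ℱ n] fun ω => D' ω i := fun i hi =>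
        (hD'm i).mono (ℱ.mono (Nat.lt_succ_iff.1 hi)) le_rfl
      have htr : Measurable[ℱ n] fun ω => truncSeq (n + 1) (D' ω) := measurable_truncSeq_comp hi
      have htr' : Measurable[ℱ n] fun ω => truncSeq (n + 1) (fun k => -D' ω k) :=
        measurable_truncSeq_comp fun i h => (hi i h).neg
      exact (hzero _ (htr hs)).trans (hzero _ (htr' hs)).symm
  have key := eLpNorm_sum_smul_le_of_centered heven hhom hcont hp1 hp hC (hm.submodule Y)
    (ξ := ξ) hξ hLν h0 N
  have hsum : ∀ c : ℕ → 𝕜, eLpNorm (fun y : ℕ → Y => ∑ i ∈ Finset.range N, c i • y i) p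
      (symmetrizedLaw μ D') = eLpNorm (fun ω => ∑ i ∈ Finset.range N, c i • D i ω) p μ := by
    intro c
    have hF : Measurable fun y : ℕ → Y => ∑ i ∈ Finset.range N, c i • y i :=
      Finset.measurable_fun_sum _ fun i _ => (measurable_pi_apply i).const_smul (c i)
    rw [eLpNorm_symmetrizedLaw hD' hF (fun y => by
      simp only [smul_neg, Finset.sum_neg_distrib, norm_neg]) hp0 hp]
    refine eLpNorm_congr_norm_ae (ae_of_all _ fun ω => ?_)
    rw [Submodule.coe_norm]
    simp [D']
  have h1 := hsum fun _ => 1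
  simp only [one_smul] at h1
  rw [hsum fun i => m (ξ i), h1] at key
  simpa only [hξε] using key

/-! ### From two distinct coefficients to the UMD property. -/

/-- If the multipliers with coefficients `0` and `1` are bounded by `K`, then so are those with
coefficients in `[0, 1]`. -/
lemma eLpNorm_sum_smul_le_of_mem_Icc {Ω : Type*} {mΩ : MeasurableSpace Ω} {μ : Measure Ω}
    {p : ℝ≥0∞} (hp1 : 1 ≤ p) {N : ℕ} {D : Fin N → Ω → X} (hD : ∀ n, AEStronglyMeasurable (D n) μ)
    {K : ℝ≥0∞} (hK : ∀ r : Fin N → ℝ, (∀ n, r n = 0 ∨ r n = 1) →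
      eLpNorm (fun ω => ∑ n, r n • D n ω) p μ ≤ K)
    {r : Fin N → ℝ} (hr : ∀ n, r n ∈ Set.Icc (0 : ℝ) 1) :
    eLpNorm (fun ω => ∑ n, r n • D n ω) p μ ≤ K := by
  have hmeas : ∀ r : Fin N → ℝ, AEStronglyMeasurable (fun ω => ∑ n, r n • D n ω) μ := fun r =>
    Finset.aestronglyMeasurable_fun_sum _ fun n _ => (hD n).const_smul (r n)
  have hconv : Convex ℝ {r : Fin N → ℝ | eLpNorm (fun ω => ∑ n, r n • D n ω) p μ ≤ K} := by
    intro r hr r' hr' a b ha hb hab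
    have heq : (fun ω => ∑ n, (a • r + b • r') n • D n ω) =
        (a • fun ω => ∑ n, r n • D n ω) + b • fun ω => ∑ n, r' n • D n ω := by
      ext ω
      simp [Finset.smul_sum, ← Finset.sum_add_distrib, add_smul, smul_smul]
    change eLpNorm _ p μ ≤ K
    rw [heq]
    refine (eLpNorm_add_le ((hmeas _).const_smul a) ((hmeas _).const_smul b) hp1).trans ?_
    rw [eLpNorm_const_smul, eLpNorm_const_smul]
    calc _ ≤ ‖a‖ₑ * K + ‖b‖ₑ * K := by gcongr <;> assumption
      _ = K := by
        rw [← add_mul, Real.enorm_of_nonneg ha, Real.enorm_of_nonneg hb,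
          ← ENNReal.ofReal_add ha hb, hab, ENNReal.ofReal_one, one_mul]
  have hsub : (Set.univ.pi fun _ : Fin N => ({0, 1} : Set ℝ)) ⊆
      {r : Fin N → ℝ | eLpNorm (fun ω => ∑ n, r n • D n ω) p μ ≤ K} := fun r hr =>
    hK r fun n => by simpa using hr n (Set.mem_univ n)
  -- The admissible coefficients form a convex set containing the vertices of the cube, whose hull
  -- is the whole cube.
  refine convexHull_min hsub hconv ?_
  rw [convexHull_pi]
  intro n _
  rw [convexHull_pair, segment_eq_Icc zero_le_one]
  exact hr n

/-- For `r n ∈ {0, 1}` the scalars `β + (α - β) * r n` lie in `{α, β}`; solving for the sum with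
coefficients `r n` gives the constant `K`. Positive and negative parts cost a factor `2`, real and
imaginary parts another, whence `4 * K`. -/
theorem isUMD_of_umdBound {p : ℝ≥0∞} (hp1 : 1 < p) (hp : p < ⊤) {A : Set 𝕜} {C : ℝ≥0∞}
    (hC : C ≠ ⊤) (h : UMDBound.{u, v, w} X p A C) {α β : 𝕜} (hα : α ∈ A) (hβ : β ∈ A)
    (hαβ : α ≠ β) : IsUMD.{u, v, w} 𝕜 X := by
  classical
  have hαβ' : ‖α - β‖ₑ ≠ 0 := by simpa [sub_eq_zero] using hαβ
  set K : ℝ≥0∞ := ‖α - β‖ₑ⁻¹ * (C + ‖β‖ₑ) with hK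
  have hKt : 4 * K ≠ ⊤ := ENNReal.mul_ne_top (by simp)
    (ENNReal.mul_ne_top (ENNReal.inv_ne_top.2 hαβ') (ENNReal.add_ne_top.2 ⟨hC, enorm_ne_top⟩))
  refine ⟨p, hp1, hp, (4 * K).toNNReal, ?_⟩
  rw [ENNReal.coe_toNNReal hKt]
  intro Ω mΩ μ hμ ℱ D hD hL N ε hε
  set F := eLpNorm (fun ω => ∑ n ∈ Finset.range N, D n ω) p μ with hF
  have hDm : ∀ n : Fin N, AEStronglyMeasurable (D n) μ := fun n => (hL n).aestronglyMeasurable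
  have hmeas : ∀ c : ℕ → 𝕜, AEStronglyMeasurable (fun ω => ∑ n ∈ Finset.range N, c n • D n ω) μ :=
    fun c => Finset.aestronglyMeasurable_fun_sum _ fun n _ => (hL n).aestronglyMeasurable.const_smul _
  have h01 : ∀ r : Fin N → ℝ, (∀ n, r n = 0 ∨ r n = 1) →
      eLpNorm (fun ω => ∑ n : Fin N, r n • D n ω) p μ ≤ K * F := by
    intro r hr
    have hab := h Ω mΩ μ hμ ℱ D hD hL N
      -- Beyond `N` the value is immaterial to the sum, but it has to lie in `A`.
      (fun n => if hn : n < N then (if r ⟨n, hn⟩ = 0 then β else α) else α) (by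
        intro n
        split_ifs <;> assumption)
    set η : ℕ → 𝕜 := fun n => if hn : n < N then (if r ⟨n, hn⟩ = 0 then β else α) else α
    have heq : (α - β) • (fun ω => ∑ n : Fin N, r n • D n ω) =
        (fun ω => ∑ n ∈ Finset.range N, η n • D n ω) -
          β • fun ω => ∑ n ∈ Finset.range N, (1 : 𝕜) • D n ω := by
      ext ω
      simp only [Pi.smul_apply, Pi.sub_apply, Finset.sum_range, Finset.smul_sum,
        ← Finset.sum_sub_distrib, one_smul]
      refine Finset.sum_congr rfl fun n _ => ?_
      rcases hr n with h0 | h0 <;> simp [η, h0, sub_smul]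
    have hle : ‖α - β‖ₑ * eLpNorm (fun ω => ∑ n : Fin N, r n • D n ω) p μ ≤ (C + ‖β‖ₑ) * F := by
      rw [← eLpNorm_const_smul, heq]
      refine (eLpNorm_sub_le (hmeas _) ((hmeas _).const_smul β) hp1.le).trans ?_
      rw [eLpNorm_const_smul, add_mul]
      simp only [one_smul]
      gcongr
    calc _ = ‖α - β‖ₑ⁻¹ * (‖α - β‖ₑ * eLpNorm (fun ω => ∑ n : Fin N, r n • D n ω) p μ) := by
          rw [← mul_assoc, ENNReal.inv_mul_cancel hαβ' enorm_ne_top, one_mul]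
      _ ≤ ‖α - β‖ₑ⁻¹ * ((C + ‖β‖ₑ) * F) := by gcongr
      _ = K * F := by rw [hK, mul_assoc]
  have hreal : ∀ r : Fin N → ℝ, (∀ n, |r n| ≤ 1) →
      eLpNorm (fun ω => ∑ n : Fin N, r n • D n ω) p μ ≤ 2 * (K * F) := by
    intro r hr
    have heq : (fun ω => ∑ n : Fin N, r n • D n ω) =
        (fun ω => ∑ n : Fin N, (fun n => (r n)⁺) n • D n ω) -
          fun ω => ∑ n : Fin N, (fun n => (r n)⁻) n • D n ω := by
      ext ω
      simp only [Pi.sub_apply, ← Finset.sum_sub_distrib, ← sub_smul, posPart_sub_negPart]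
    have hm' : ∀ r : Fin N → ℝ, AEStronglyMeasurable (fun ω => ∑ n : Fin N, r n • D n ω) μ :=
      fun r => Finset.aestronglyMeasurable_fun_sum _ fun n _ => (hDm n).const_smul (r n)
    rw [heq, two_mul]
    refine (eLpNorm_sub_le (hm' _) (hm' _) hp1.le).trans (add_le_add ?_ ?_)
    · exact eLpNorm_sum_smul_le_of_mem_Icc hp1.le hDm h01 fun n =>
        ⟨posPart_nonneg _, by
          rw [posPart_def]; exact sup_le ((le_abs_self _).trans (hr n)) zero_le_one⟩
    · exact eLpNorm_sum_smul_le_of_mem_Icc hp1.le hDm h01 fun n =>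
        ⟨negPart_nonneg _, by
          rw [negPart_def]; exact sup_le ((neg_le_abs _).trans (hr n)) zero_le_one⟩
  have heq : (fun ω => ∑ n ∈ Finset.range N, ε n • D n ω) =
      (fun ω => ∑ n : Fin N, (fun n : Fin N => RCLike.re (ε n)) n • D n ω) +
        (RCLike.I : 𝕜) • fun ω => ∑ n : Fin N, (fun n : Fin N => RCLike.im (ε n)) n • D n ω := by
    ext ω
    simp only [Pi.smul_apply, Pi.add_apply, Finset.sum_range, Finset.smul_sum,
      ← Finset.sum_add_distrib]
    refine Finset.sum_congr rfl fun n _ => ?_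
    conv_lhs => rw [← RCLike.re_add_im (ε n), add_smul]
    rw [RCLike.real_smul_eq_coe_smul (K := 𝕜), RCLike.real_smul_eq_coe_smul (K := 𝕜), smul_smul,
      mul_comm]
  have hm' : ∀ r : Fin N → ℝ, AEStronglyMeasurable (fun ω => ∑ n : Fin N, r n • D n ω) μ :=
    fun r => Finset.aestronglyMeasurable_fun_sum _ fun n _ => (hDm n).const_smul (r n)
  rw [heq]
  refine (eLpNorm_add_le (hm' _) ((hm' _).const_smul _) hp1.le).trans ?_
  rw [eLpNorm_const_smul]
  have hI : ‖(RCLike.I : 𝕜)‖ₑ ≤ 1 := by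
    rw [← ofReal_norm, ENNReal.ofReal_le_one]
    obtain h | h := RCLike.I_eq_zero_or_im_I_eq_one (K := 𝕜)
    · simp [h]
    · rw [RCLike.norm_I_of_ne_zero]
      intro h0
      simp [h0] at h
  calc _ ≤ 2 * (K * F) + 1 * (2 * (K * F)) := by
        gcongr
        · exact hreal _ fun n => (RCLike.abs_re_le_norm _).trans (hε n).le
        · exact hreal _ fun n => (RCLike.abs_im_le_norm _).trans (hε n).le
    _ = 4 * K * F := by ring

end

end

theorem theorem4p1 {𝕜 : Type w} [RCLike 𝕜] {d : ℕ} (hd : 1 ≤ d)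
    (m : EuclideanSpace ℝ (Fin d) → 𝕜)
    (heven : ∀ x, m (-x) = m x)
    (hhom : ∀ c : ℝ, 0 < c → ∀ x, m (c • x) = m x)
    (hcont : ContinuousOn m {0}ᶜ)
    (X : Type u) [NormedAddCommGroup X] [NormedSpace ℝ X] [NormedSpace 𝕜 X]
    [IsScalarTower ℝ 𝕜 X] [CompleteSpace X]
    (p : ℝ≥0∞) (hp1 : 1 < p) (hp : p < ⊤) :
    umdConst.{u, v, w} X p (m '' {0}ᶜ) ≤ multiplierNorm X p m ∧
      (¬ IsUMD.{u, v, w} 𝕜 X → (∃ x y, x ≠ 0 ∧ y ≠ 0 ∧ m x ≠ m y) →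
        multiplierNorm X p m = ⊤) := by
  have key : ∀ C : ℝ≥0∞, C ≠ ⊤ → MultiplierBound X p m C →
      UMDBound.{u, v, w} X p (m '' {0}ᶜ) C := fun C hC hm =>
    umdBound_of_multiplierBound heven hhom hcont hp1.le hp.ne hC hm
  refine ⟨le_sInf fun C hm => ?_, fun hX ⟨x, y, hx, hy, hxy⟩ => ?_⟩
  · by_cases hC : C = ⊤
    · rw [hC]
      exact le_top
    · exact sInf_le (key C hC hm)
  · refine sInf_eq_top.2 fun C hm => ?_
    by_contra hC
    exact hX (isUMD_of_umdBound hp1 hp hC (key C hC hm) ⟨x, hx, rfl⟩ ⟨y, hy, rfl⟩ hxy)
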